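/- Let $(W,H,\mu)$ be an abstract Wiener space: $W$ is a separable Banach space, $H$ is a Hilbert space continuously and densely embedded in $W$, and every $\varphi\in W^*\subset H^*=H$ has law $N(0,|\varphi|_H^2)$ under $\mu$. For $h\in H$ let $\delta(h)\in L^2(\mu)$ be the $L^2$-limit of $\varphi_n(w)$ for $\varphi_n\in W^*$, $\varphi_n\to h$ in $H$. Let $\mathbb D_{2,1}(H)$ be the domain in $L^2(\mu;H)$ of the closure $\nabla$ of the gradient $\sum_j f_j(\delta(h_1),\dots,\delta(h_n))x_j\mapsto\sum_{i,j}\partial_i f_j(\delta(h_1),\dots,\delta(h_n))\,x_j\otimes h_i$ on smooth cylindrical functionals, with values in $L^2(\mu;H\otimes H)$; $x\otimes h$ is identified with the Hilbert–Schmidt operator $k\mapsto (h,k)_H\,x$. A Hilbert–Schmidt operator $T$ is called quasinilpotent if $\|T^n\|^{1/n}\to0$. A continuous strictly increasing resolution of the identity is a family $(\pi_\theta)_{0\le\theta\le1}$ of orthogonal projections on $H$ with strictly increasing ranges, $\pi_0=0$, $\pi_1=I$, and $\theta\mapsto\pi_\theta h$ continuous for every $h\in H$. It induces the filtration $\mathcal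 F_\theta=\sigma\{\delta(\pi_\theta h):h\in H\}$, and an $H$-valued random variable $v$ is adapted to it if $(v,\pi_\theta h)_H$ is $\mathcal F_\theta$-measurable (up to a.s. equality) for all $\theta\in[0,1]$ and $h\in H$. Let $(e_i)_{i\ge1}$ be a complete orthonormal basis of $H$, let $\alpha>0$, and set $$u=\sum_{i=1}^\infty 2^{-i\alpha}\,\delta(e_{i+1})\,e_i .$$ Then the series converges a.s. in $H$; $u\in\mathbb D_{2,1}(H)$; almost surely $\nabla u$ is the weighted shift $(\nabla u)h=\sum_{i=1}^\infty 2^{-i\alpha}(e_{i+1},h)_H\,e_i$ for all $h\in H$, and it is quasinilpotent. Nevertheless, there is no continuous strictly increasing resolution of the identity on $H$ such that $u$ is adapted to the filtration it induces. Consequently the converse of "$v$ adapted $\Rightarrow\nabla v$ a.s. quasinilpotent" fails: it is not true that every $v\in\mathbb D_{2,1}(H)$ whose gradient is a.s. quasinilpotent is adapted to the filtration induced by some continuous strictly increasing resolution of the identity. -/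

import Mathlib

open MeasureTheory ProbabilityTheory Filter Topology
open scoped ENNReal NNReal InnerProductSpace

noncomputable section

/-- An abstract Wiener space `(W, H, μ)`: the Hilbert space `H` is continuously and densely embedded
in the Banach space `W` by `ι`, and every `φ` in the dual of `W` has under `μ` the law
`N(0, |φ|_H ^ 2)`, where `|φ|_H` is the norm of `φ` restricted to `H`, an element of `H* = H`. -/
structure AbstractWienerSpace (W H : Type*) [NormedAddCommGroup W] [NormedSpace ℝ W]
    [MeasurableSpace W] [NormedAddCommGroup H] [InnerProductSpace ℝ H] where
  ι : H →L[ℝ] W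
  injective_ι : Function.Injective ι
  denseRange_ι : DenseRange ι
  μ : Measure W
  isProbabilityMeasure : IsProbabilityMeasure μ
  map_dual : ∀ φ : StrongDual ℝ W, μ.map φ = gaussianReal 0 (‖φ.comp ι‖₊ ^ 2)

/-- The square of the Hilbert-Schmidt norm of `T`, in `[0, ∞]`. By Bessel and Parseval the supremum
is the usual sum of `‖T b‖ ^ 2` over the vectors `b` of any orthonormal basis. -/
def hsNormSq {H X : Type*} [NormedAddCommGroup H] [InnerProductSpace ℝ H]
    [NormedAddCommGroup X] [InnerProductSpace ℝ X] (T : H →L[ℝ] X) : ℝ≥0∞ :=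
  ⨆ (s : Finset H) (_ : Orthonormal ℝ (fun x : s => (x : H))), ∑ x ∈ s, ‖T x‖ₑ ^ 2

/-- A quasinilpotent Hilbert-Schmidt operator: `‖T ^ n‖ ^ (1 / n) → 0` (operator norm). -/
def IsQuasinilpotent {H : Type*} [NormedAddCommGroup H] [InnerProductSpace ℝ H]
    (T : H →L[ℝ] H) : Prop :=
  hsNormSq T < ∞ ∧ Tendsto (fun n : ℕ => ‖T ^ n‖ ^ (1 / (n : ℝ))) atTop (𝓝 0)

/-- A continuous strictly increasing resolution of the identity `π_θ`, `0 ≤ θ ≤ 1`, on `H`: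
orthogonal projections with strictly increasing ranges, `π_0 = 0`, `π_1 = 1`, strongly continuous
in `θ`. -/
structure ContinuousResolution (H : Type*) [NormedAddCommGroup H] [InnerProductSpace ℝ H]
    [CompleteSpace H] where
  proj : Set.Icc (0 : ℝ) 1 → H →L[ℝ] H
  isStarProjection : ∀ θ, IsStarProjection (proj θ)
  strictMono_range : StrictMono (fun θ => (proj θ).range)
  proj_zero : proj 0 = 0
  proj_one : proj 1 = 1
  continuous_apply : ∀ h, Continuous (fun θ => proj θ h)

namespace AbstractWienerSpace

section
variable {W H : Type*} [NormedAddCommGroup W] [NormedSpace ℝ W] [MeasurableSpace W] [BorelSpace W]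
  [NormedAddCommGroup H] [InnerProductSpace ℝ H]

instance (A : AbstractWienerSpace W H) : IsProbabilityMeasure A.μ := A.isProbabilityMeasure

theorem memLp_dual (A : AbstractWienerSpace W H) (φ : StrongDual ℝ W) :
    MemLp (fun w => φ w) 2 A.μ := by
  have h : MemLp id 2 (A.μ.map φ) := by
    rw [A.map_dual]; exact memLp_id_gaussianReal 2
  exact (memLp_map_measure_iff (f := fun w => φ w) (by fun_prop) (by fun_prop)).1 h

/-- A continuous linear functional on `W` as an element of `L²(μ)`. -/
def dualToLp (A : AbstractWienerSpace W H) : StrongDual ℝ W →ₗ[ℝ] Lp ℝ 2 A.μ where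
  toFun φ := (A.memLp_dual φ).toLp
  map_add' _ _ := rfl
  map_smul' _ _ := rfl

variable [CompleteSpace H]

/-- The embedding of the dual of `W` into `H* = H`. -/
def dualToH (A : AbstractWienerSpace W H) : StrongDual ℝ W →ₗ[ℝ] H where
  toFun φ := (InnerProductSpace.toDual ℝ H).symm (φ.comp A.ι)
  map_add' φ ψ := by simp
  map_smul' c φ := by simp

/-- `δ(h)`, as an element of `L²(μ)`: the continuous extension to `H` of `φ ↦ φ(w)`, which is an
isometry from the dual of `W`, with the norm of `H`, into `L²(μ)`. -/
def delta (A : AbstractWienerSpace W H) : H →L[ℝ] Lp ℝ 2 A.μ :=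
  A.dualToLp.extendOfNorm A.dualToH

theorem norm_dualToLp (A : AbstractWienerSpace W H) (φ : StrongDual ℝ W) :
    ‖A.dualToLp φ‖ = ‖A.dualToH φ‖ := by
  have h1 : ‖A.dualToLp φ‖ ^ 2 = ∫ w, (φ w) ^ 2 ∂A.μ := by
    have h := A.memLp_dual φ
    rw [← real_inner_self_eq_norm_sq, L2.inner_def]
    apply integral_congr_ae
    filter_upwards [h.coeFn_toLp] with w hw
    change ⟪(h.toLp) w, (h.toLp) w⟫_ℝ = _
    rw [hw]; simp [sq]
  have h2 : ∫ w, (φ w) ^ 2 ∂A.μ = ‖φ.comp A.ι‖ ^ 2 := by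
    have h := variance_fun_id_gaussianReal (μ := 0) (v := ‖φ.comp A.ι‖₊ ^ 2)
    rw [variance_of_integral_eq_zero (by fun_prop) (by simp), ← A.map_dual,
      integral_map (by fun_prop) (by fun_prop)] at h
    simpa using h
  have h3 : ‖A.dualToH φ‖ = ‖φ.comp A.ι‖ := by
    simp [dualToH]
  rw [← h3, ← h1] at h2
  exact (sq_eq_sq₀ (norm_nonneg _) (norm_nonneg _)).1 (h1.trans (h1.symm.trans h2))

theorem denseRange_dualToH (A : AbstractWienerSpace W H) : DenseRange A.dualToH := by
  have h : (A.dualToH.range)ᗮ = ⊥ := by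
    rw [Submodule.eq_bot_iff]
    intro x hx
    apply A.injective_ι
    rw [map_zero]
    apply SeparatingDual.eq_zero_of_forall_dual_eq_zero (R := ℝ)
    intro φ
    have := (Submodule.mem_orthogonal _ _).1 hx (A.dualToH φ) ⟨φ, rfl⟩
    simpa [dualToH] using this
  rw [← Submodule.topologicalClosure_eq_top_iff] at h
  exact Submodule.dense_iff_topologicalClosure_eq_top.2 h

/-- On the dual of `W`, `δ` is evaluation. -/
theorem delta_dualToH (A : AbstractWienerSpace W H) (φ : StrongDual ℝ W) :
    A.delta (A.dualToH φ) =ᵐ[A.μ] fun w => φ w := by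
  rw [delta, LinearMap.extendOfNorm_eq A.denseRange_dualToH
    ⟨1, fun φ => by rw [one_mul, norm_dualToLp]⟩]
  exact (A.memLp_dual φ).coeFn_toLp

theorem norm_delta (A : AbstractWienerSpace W H) (h : H) : ‖A.delta h‖ = ‖h‖ := by
  refine A.denseRange_dualToH.induction_on (p := fun h => ‖A.delta h‖ = ‖h‖) h
    (isClosed_eq (by fun_prop) (by fun_prop)) fun φ => ?_
  rw [delta, LinearMap.extendOfNorm_eq A.denseRange_dualToH
    ⟨1, fun φ => by rw [one_mul, norm_dualToLp]⟩, norm_dualToLp]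

end

end AbstractWienerSpace

/-- The data of a smooth cylindrical `X`-valued functional
`F = ∑_{j < m} f_j(δ(h_0), …, δ(h_{n-1})) x_j`, where each `f_j` is smooth with all derivatives of
polynomial growth. -/
structure SmoothCylinder (H X : Type*) where
  n : ℕ
  m : ℕ
  dir : Fin n → H
  coeff : Fin m → (Fin n → ℝ) → ℝ
  temperate : ∀ j, (coeff j).HasTemperateGrowth
  vec : Fin m → X

namespace AbstractWienerSpace

variable {W H X : Type*} [NormedAddCommGroup W] [NormedSpace ℝ W] [MeasurableSpace W] [BorelSpace W]
  [NormedAddCommGroup H] [InnerProductSpace ℝ H] [CompleteSpace H]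
  [NormedAddCommGroup X] [InnerProductSpace ℝ X]

/-- The value of a smooth cylindrical functional. -/
def cylinderEval (A : AbstractWienerSpace W H) (F : SmoothCylinder H X) (w : W) : X :=
  ∑ j, F.coeff j (fun i => A.delta (F.dir i) w) • F.vec j

/-- The gradient of a smooth cylindrical functional, as an operator from `H` to `X`:
`(∇F) k = ∑_j (∑_i (∂_i f_j)(δ(h_0), …, δ(h_{n-1})) (h_i, k)) x_j`. -/
def cylinderGrad (A : AbstractWienerSpace W H) (F : SmoothCylinder H X) (w : W) : H →L[ℝ] X :=
  ∑ j, (∑ i, fderiv ℝ (F.coeff j) (fun l => A.delta (F.dir l) w) (Pi.single i 1) •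
    innerSL ℝ (F.dir i)).smulRight (F.vec j)

/-- `u` lies in the Sobolev space `𝔻_{2,1}(X)` and `G` is (a version of) its gradient `∇u`, where
`∇ : L²(μ; X) → L²(μ; X ⊗ H)` is the closure of the gradient on smooth cylindrical functionals and
`X ⊗ H` is the space of Hilbert-Schmidt operators from `H` to `X`. -/
structure IsGradient (A : AbstractWienerSpace W H) (u : W → X) (G : W → H →L[ℝ] X) : Prop where
  memLp : MemLp u 2 A.μ
  aestronglyMeasurable : ∀ h, AEStronglyMeasurable (fun w => G w h) A.μ
  lintegral_lt_top : ∫⁻ w, hsNormSq (G w) ∂A.μ < ∞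
  exists_approx : ∃ F : ℕ → SmoothCylinder H X,
    Tendsto (fun n => eLpNorm (fun w => A.cylinderEval (F n) w - u w) 2 A.μ) atTop (𝓝 0) ∧
    Tendsto (fun n => ∫⁻ w, hsNormSq (A.cylinderGrad (F n) w - G w) ∂A.μ) atTop (𝓝 0)

/-- `u` lies in the Sobolev space `𝔻_{2,1}(X)`. -/
def MemD21 (A : AbstractWienerSpace W H) (u : W → X) : Prop :=
  ∃ G : W → H →L[ℝ] X, A.IsGradient u G

/-- The gradient of `u` is almost surely quasinilpotent (for every version of the gradient). -/
def HasQuasinilpotentGradient (A : AbstractWienerSpace W H) (u : W → H) : Prop :=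
  ∀ G : W → H →L[ℝ] H, A.IsGradient u G → ∀ᵐ w ∂A.μ, IsQuasinilpotent (G w)

/-- The σ-algebra `F_θ = σ{δ(π_θ h) : h ∈ H}`. -/
@[reducible]
def filtration (A : AbstractWienerSpace W H) (π : ContinuousResolution H)
    (θ : Set.Icc (0 : ℝ) 1) : MeasurableSpace W :=
  ⨆ h : H, MeasurableSpace.comap (A.delta (π.proj θ h)) (borel ℝ)

/-- `u` is adapted to the filtration induced by `π`: for all `θ` and `h`, `(u, π_θ h)` is
`F_θ`-measurable. Random variables being identified when they are a.s. equal, this means a.s.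
equality with an `F_θ`-measurable function. -/
def IsAdapted (A : AbstractWienerSpace W H) (π : ContinuousResolution H) (u : W → H) : Prop :=
  ∀ θ h, AEStronglyMeasurable[A.filtration π θ] (fun w => ⟪u w, π.proj θ h⟫_ℝ) A.μ

/-- The functional `u = ∑_{i ≥ 1} 2^{-iα} δ(e_{i+1}) e_i`. Lean counts from `0`: the vectors
`e_1, e_2, …` are `e 0, e 1, …`. -/
def shiftField (A : AbstractWienerSpace W H) (e : HilbertBasis ℕ ℝ H) (α : ℝ) (w : W) : H :=
  ∑' i : ℕ, ((2 : ℝ) ^ (-((i : ℝ) + 1) * α) * A.delta (e (i + 1)) w) • e i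

end AbstractWienerSpace

end

/-!
The gradient of `u = ∑ a i * δ(e (i + 1)) • e i`, here with `a i = 2 ^ (-(i + 1) * α)`, is the
weighted backward shift `B : e (i + 1) ↦ a i • e i`, and `⟪u, x⟫ = δ(B† x)`. Suppose `u` is adapted
to the filtration of a resolution `π`. Then `δ(B† (π_θ x))` is `F_θ`-measurable, while `δ(y)` is
independent of `F_θ` for `y` orthogonal to the range of `π_θ`; hence `B†` preserves the range of
`π_θ`, and `B` preserves its kernel.

However, `B` is a Donoghue operator: a nonzero closed `B`-invariant subspace `K` contains `e 0`.
Indeed, for `x ∈ K` the vector `B ^ m x` is, after rescaling, `⟪e m, x⟫ • e 0` up to an error of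
norm `(a m / a 0) * (∑_{i > m} ⟪e i, x⟫²) ^ (1 / 2)`. If `e 0` has positive distance from `K`, this
bounds `⟪e m, x⟫²` by `C * (a m)²` times the tail sum beyond `m`, and since `∑ (a m)² < ∞` the tail
sums can tend to `0` only if `x = 0`. As `θ ↦ ‖π_θ (e 0)‖` takes the value `1 / 2`, some kernel of
`π` violates this.

Quasinilpotence follows from `‖B ^ n‖ ≤ a 0 ⋯ a (n - 1)` and the inequality of arithmetic and
geometric means, and the uniqueness of the gradient from Gaussian integration by parts against
cylindrical functionals.
-/

theorem map_eq_sum_smul_map_single {ι E : Type*} [Fintype ι] [DecidableEq ι]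
    [NormedAddCommGroup E] [NormedSpace ℝ E] (L : (ι → ℝ) →L[ℝ] E) (x : ι → ℝ) :
    L x = ∑ i, x i • L (Pi.single i 1) := by
  conv_lhs => rw [pi_eq_sum_univ' x, map_sum]
  simp only [map_smul]

namespace AbstractWienerSpace

section GaussianField

variable {W H : Type*} [NormedAddCommGroup W] [NormedSpace ℝ W] [MeasurableSpace W] [BorelSpace W]
  [NormedAddCommGroup H] [InnerProductSpace ℝ H] [CompleteSpace H] (A : AbstractWienerSpace W H)

theorem measurable_delta (h : H) : Measurable (A.delta h) :=
  (Lp.stronglyMeasurable _).measurable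

theorem memLp_delta (h : H) : MemLp (A.delta h) 2 A.μ :=
  Lp.memLp _

theorem delta_sum {ι : Type*} (s : Finset ι) (c : ι → ℝ) (h : ι → H) :
    A.delta (∑ i ∈ s, c i • h i) =ᵐ[A.μ] fun w => ∑ i ∈ s, c i * A.delta (h i) w := by
  rw [map_sum]
  filter_upwards [Lp.coeFn_finsetSum s fun i => A.delta (c i • h i),
    (ae_ball_iff s.countable_toSet).2 fun i _ => Lp.coeFn_smul (c i) (A.delta (h i))]
    with w sum_eq smul_eq
  rw [sum_eq, Finset.sum_apply]
  refine Finset.sum_congr rfl fun i hi => ?_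
  rw [map_smul, smul_eq i hi, Pi.smul_apply, smul_eq_mul]

theorem delta_sub_smul (h k : H) (c : ℝ) :
    A.delta (h - c • k) =ᵐ[A.μ] fun w => A.delta h w - c * A.delta k w := by
  rw [map_sub, map_smul]
  filter_upwards [Lp.coeFn_sub (A.delta h) (c • A.delta k), Lp.coeFn_smul c (A.delta k)]
    with w sub_eq smul_eq
  rw [sub_eq, Pi.sub_apply, smul_eq, Pi.smul_apply, smul_eq_mul]

theorem inner_delta (h k : H) : ⟪A.delta h, A.delta k⟫_ℝ = ⟪h, k⟫_ℝ :=
  LinearIsometry.inner_map_map ⟨(A.delta : H →ₗ[ℝ] Lp ℝ 2 A.μ), A.norm_delta⟩ h k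

theorem integral_delta_mul_delta (h k : H) :
    ∫ w, A.delta h w * A.delta k w ∂A.μ = ⟪h, k⟫_ℝ := by
  rw [← A.inner_delta, L2.inner_def]
  simp [mul_comm]

theorem map_delta (h : H) : A.μ.map (A.delta h) = gaussianReal 0 (‖h‖₊ ^ 2) := by
  obtain ⟨k, hk_range, hk⟩ := mem_closure_iff_seq_limit.1 (A.denseRange_dualToH h)
  choose φ hφ using hk_range
  have law_φ (n : ℕ) : A.μ.map (A.delta (k n)) = gaussianReal 0 (‖k n‖₊ ^ 2) := by
    rw [← hφ n, Measure.map_congr (A.delta_dualToH (φ n)), A.map_dual]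
    simp [dualToH]
  have tendsto_law : TendstoInDistribution (fun n => A.delta (k n)) atTop (A.delta h)
      (fun _ => A.μ) A.μ :=
    (tendstoInMeasure_of_tendsto_Lp ((A.delta.continuous.tendsto h).comp hk)).tendstoInDistribution
      fun n => (A.measurable_delta _).aemeasurable
  have tendsto_charFun := ProbabilityMeasure.tendsto_iff_tendsto_charFun.1 tendsto_law.tendsto
  have := Measure.isProbabilityMeasure_map (μ := A.μ) (A.measurable_delta h).aemeasurable
  refine Measure.ext_of_charFun (funext fun t => tendsto_nhds_unique (tendsto_charFun t) ?_)
  simp only [ProbabilityMeasure.coe_mk, law_φ, charFun_gaussianReal]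
  have : Continuous fun h : H =>
      Complex.exp (t * (0 : ℝ) * Complex.I - (‖h‖₊ ^ 2 : ℝ≥0) * t ^ 2 / 2) := by
    simp only [NNReal.coe_pow, coe_nnnorm]
    fun_prop
  exact (this.tendsto h).comp hk

theorem integral_delta (h : H) : ∫ w, A.delta h w ∂A.μ = 0 := by
  have := integral_map (μ := A.μ) (A.measurable_delta h).aemeasurable
    (f := fun x : ℝ => x) (by fun_prop)
  rw [← this, A.map_delta, integral_id_gaussianReal]

theorem covariance_delta (h k : H) :
    cov[fun w => A.delta h w, fun w => A.delta k w; A.μ] = ⟪h, k⟫_ℝ := by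
  rw [covariance_eq_sub (A.memLp_delta h) (A.memLp_delta k), A.integral_delta, zero_mul, sub_zero]
  exact A.integral_delta_mul_delta h k

theorem hasGaussianLaw_delta {ι : Type*} [Finite ι] (h : ι → H) :
    HasGaussianLaw (fun w i => A.delta (h i) w) A.μ := by
  classical
  have := Fintype.ofFinite ι
  have hm : Measurable fun w i => A.delta (h i) w :=
    measurable_pi_lambda _ fun i => A.measurable_delta (h i)
  refine ⟨isGaussian_of_map_eq_gaussianReal fun L => ⟨0, ‖∑ i, L (Pi.single i 1) • h i‖₊ ^ 2, ?_⟩⟩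
  rw [Measure.map_map (by fun_prop) hm, ← A.map_delta]
  refine Measure.map_congr ?_
  filter_upwards [A.delta_sum Finset.univ (fun i => L (Pi.single i 1)) h] with w hw
  rw [hw, Function.comp_apply, map_eq_sum_smul_map_single]
  simp only [smul_eq_mul, mul_comm]

theorem isGaussianProcess_delta : IsGaussianProcess (fun h w => A.delta h w) A.μ :=
  ⟨fun I => A.hasGaussianLaw_delta (fun i : I => (i : H))⟩

theorem indepFun_delta_of_inner_eq_zero {S T : Type*} (f : S → H) (g : T → H)
    (hfg : ∀ s t, ⟪f s, g t⟫_ℝ = 0) :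
    IndepFun (fun w s => A.delta (f s) w) (fun w t => A.delta (g t) w) A.μ := by
  refine IsGaussianProcess.indepFun_of_covariance_eq_zero (X := fun s w => A.delta (f s) w)
    (Y := fun t w => A.delta (g t) w) ?_ (fun s => (A.measurable_delta _).aemeasurable)
    (fun t => (A.measurable_delta _).aemeasurable) fun s t => ?_
  · have h := A.isGaussianProcess_delta.comp_right (Sum.elim f g)
    rwa [Sum.comp_elim] at h
  · exact (A.covariance_delta _ _).trans (hfg s t)

end GaussianField

end AbstractWienerSpace

section GaussianIntegrationByParts

theorem hasDerivAt_gaussianPDFReal (μ : ℝ) (v : ℝ≥0) (x : ℝ) :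
    HasDerivAt (gaussianPDFReal μ v) (-((x - μ) / v) * gaussianPDFReal μ v x) x := by
  have exponent : HasDerivAt (fun y : ℝ => -(y - μ) ^ 2 / (2 * v)) (-((x - μ) / v)) x := by
    refine ((((hasDerivAt_id x).sub_const μ).pow 2).neg.div_const (2 * (v : ℝ))).congr_deriv ?_
    simp only [id_eq, Nat.cast_ofNat, Nat.add_one_sub_one, pow_one, mul_one]
    rw [neg_div, mul_div_mul_left _ _ two_ne_zero]
  exact (exponent.exp.const_mul (√(2 * Real.pi * v))⁻¹).congr_deriv
    (by rw [gaussianPDFReal]; ring)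

theorem integral_id_mul_gaussianReal {φ φ' : ℝ → ℝ} {v : ℝ≥0} (hφ : ∀ x, HasDerivAt φ (φ' x) x)
    (int_φ : Integrable φ (gaussianReal 0 v)) (int_φ' : Integrable φ' (gaussianReal 0 v))
    (int_mul : Integrable (fun x => x * φ x) (gaussianReal 0 v)) :
    ∫ x, x * φ x ∂gaussianReal 0 v = v * ∫ x, φ' x ∂gaussianReal 0 v := by
  rcases eq_or_ne v 0 with rfl | hv
  · simp
  have integrable_iff (f : ℝ → ℝ) : Integrable f (gaussianReal 0 v) ↔
      Integrable fun x => gaussianPDFReal 0 v x * f x := by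
    rw [gaussianReal_of_var_ne_zero 0 hv, integrable_withDensity_iff_integrable_smul'
      (measurable_gaussianPDF 0 v) (ae_of_all _ fun _ => gaussianPDF_lt_top)]
    simp only [toReal_gaussianPDF, smul_eq_mul]
  rw [integrable_iff] at int_φ int_φ' int_mul
  have by_parts := integral_mul_deriv_eq_deriv_mul_of_integrable
    (fun x _ => hasDerivAt_gaussianPDFReal 0 v x) (fun x _ => hφ x) int_φ'
    ((int_mul.const_mul (-(v : ℝ)⁻¹)).congr (ae_of_all _ fun x => by
      simp only [Pi.mul_apply]; ring)) int_φ
  rw [integral_gaussianReal_eq_integral_smul hv, integral_gaussianReal_eq_integral_smul hv]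
  simp only [smul_eq_mul]
  rw [by_parts, ← integral_neg, ← integral_const_mul]
  refine integral_congr_ae (ae_of_all _ fun x => ?_)
  have : (v : ℝ) ≠ 0 := by exact_mod_cast hv
  simp only [sub_zero]
  field_simp

variable {E F : Type*} [NormedAddCommGroup E] [NormedSpace ℝ E]
  [NormedAddCommGroup F] [NormedSpace ℝ F]

theorem hasTemperateGrowth_fderiv {f : E → F} (hf : f.HasTemperateGrowth) :
    (fderiv ℝ f).HasTemperateGrowth :=
  ⟨hf.1.fderiv_right (by simp), fun n => by
    simpa only [norm_iteratedFDeriv_fderiv] using hf.2 (n + 1)⟩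

theorem hasTemperateGrowth_fderiv_apply {f : E → F} (hf : f.HasTemperateGrowth) (c : E) :
    (fun x => fderiv ℝ f x c).HasTemperateGrowth :=
  (ContinuousLinearMap.apply ℝ F c).hasTemperateGrowth.comp (hasTemperateGrowth_fderiv hf)

variable [CompleteSpace E] [SecondCountableTopology E] [MeasurableSpace E] [BorelSpace E]

theorem integrable_of_hasTemperateGrowth {f : E → F} (hf : f.HasTemperateGrowth)
    (ν : Measure E) [IsGaussian ν] : Integrable f ν := by
  obtain ⟨k, C, hC⟩ := hf.2 0
  simp only [norm_iteratedFDeriv_zero] at hC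
  have int_pow : Integrable (fun x : E => ‖1 + ‖x‖‖ ^ k) ν :=
    ((memLp_const (1 : ℝ)).add
      (IsGaussian.memLp_id ν k (ENNReal.natCast_ne_top k)).norm).integrable_norm_pow'
  refine (int_pow.const_mul C).mono' hf.1.continuous.aestronglyMeasurable
    (ae_of_all _ fun x => (hC x).trans_eq ?_)
  rw [Real.norm_of_nonneg (by positivity)]

theorem integral_fst_mul_gaussianReal_prod {f : ℝ × E → ℝ} (hf : f.HasTemperateGrowth)
    (v : ℝ≥0) (ν : Measure E) [IsGaussian ν] :
    ∫ z, z.1 * f z ∂(gaussianReal 0 v).prod ν =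
      v * ∫ z, fderiv ℝ f z (1, 0) ∂(gaussianReal 0 v).prod ν := by
  have int_f := integrable_of_hasTemperateGrowth hf ((gaussianReal 0 v).prod ν)
  have int_deriv := integrable_of_hasTemperateGrowth (hasTemperateGrowth_fderiv_apply hf (1, 0))
    ((gaussianReal 0 v).prod ν)
  have int_mul : Integrable (fun z => z.1 * f z) ((gaussianReal 0 v).prod ν) :=
    integrable_of_hasTemperateGrowth ((ContinuousLinearMap.fst ℝ ℝ E).hasTemperateGrowth.mul hf) _
  rw [integral_prod_symm _ int_mul, integral_prod_symm _ int_deriv, ← integral_const_mul]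
  refine integral_congr_ae ?_
  filter_upwards [int_f.prod_left_ae, int_deriv.prod_left_ae, int_mul.prod_left_ae]
    with y int_f int_deriv int_mul
  refine integral_id_mul_gaussianReal (fun x => ?_) int_f int_deriv int_mul
  exact (hf.1.differentiable (by simp) _).hasFDerivAt.comp_hasDerivAt x
    ((hasDerivAt_id x).prodMk (hasDerivAt_const x y))

end GaussianIntegrationByParts

namespace AbstractWienerSpace

section IntegrationByParts

variable {W H : Type*} [NormedAddCommGroup W] [NormedSpace ℝ W] [MeasurableSpace W] [BorelSpace W]
  [NormedAddCommGroup H] [InnerProductSpace ℝ H] [CompleteSpace H] (A : AbstractWienerSpace W H)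
  {ι κ : Type*} [Fintype ι] [Fintype κ]

theorem memLp_two_comp_delta (h : ι → H) {f : (ι → ℝ) → ℝ} (hf : f.HasTemperateGrowth) :
    MemLp (fun w => f fun i => A.delta (h i) w) 2 A.μ := by
  have law := A.hasGaussianLaw_delta h
  have := law.isGaussian_map
  refine (memLp_map_measure_iff hf.1.continuous.aestronglyMeasurable law.aemeasurable).1 ?_
  rw [memLp_two_iff_integrable_sq hf.1.continuous.aestronglyMeasurable]
  exact integrable_of_hasTemperateGrowth (hf.pow 2) _

theorem integral_delta_mul_of_inner_eq_zero {k : H} {r : ι → H} (hr : ∀ i, ⟪k, r i⟫_ℝ = 0)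
    {f : ℝ × (ι → ℝ) → ℝ} (hf : f.HasTemperateGrowth) :
    ∫ w, A.delta k w * f (A.delta k w, fun i => A.delta (r i) w) ∂A.μ =
      ‖k‖ ^ 2 * ∫ w, fderiv ℝ f (A.delta k w, fun i => A.delta (r i) w) (1, 0) ∂A.μ := by
  have law_r := A.hasGaussianLaw_delta r
  have := law_r.isGaussian_map
  have hZ : AEMeasurable (fun w => (A.delta k w, fun i => A.delta (r i) w)) A.μ :=
    (A.measurable_delta k).aemeasurable.prodMk law_r.aemeasurable
  have indep : IndepFun (A.delta k) (fun w i => A.delta (r i) w) A.μ :=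
    (A.indepFun_delta_of_inner_eq_zero (fun _ : Unit => k) r fun _ => hr).comp
      (measurable_pi_apply ()) measurable_id
  have law := (indepFun_iff_map_prod_eq_prod_map_map (A.measurable_delta k).aemeasurable
    law_r.aemeasurable).1 indep
  have stein := integral_fst_mul_gaussianReal_prod hf (‖k‖₊ ^ 2)
    (A.μ.map fun w i => A.delta (r i) w)
  have continuous_mul : Continuous fun z => z.1 * f z := continuous_fst.mul hf.1.continuous
  have continuous_deriv := (hasTemperateGrowth_fderiv_apply hf (1, 0)).1.continuous
  rwa [← A.map_delta, ← law, integral_map hZ continuous_mul.aestronglyMeasurable,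
    integral_map hZ continuous_deriv.aestronglyMeasurable, NNReal.coe_pow, coe_nnnorm] at stein

theorem integral_delta_mul (h : ι → H) (k : H) {f : (ι → ℝ) → ℝ} (hf : f.HasTemperateGrowth) :
    ∫ w, A.delta k w * f (fun i => A.delta (h i) w) ∂A.μ =
      ∫ w, fderiv ℝ f (fun i => A.delta (h i) w) (fun i => ⟪h i, k⟫_ℝ) ∂A.μ := by
  let c : ι → ℝ := fun i => ⟪h i, k⟫_ℝ / ‖k‖ ^ 2
  let r : ι → H := fun i => h i - c i • k
  let L : ℝ × (ι → ℝ) →L[ℝ] ι → ℝ :=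
    (ContinuousLinearMap.fst ℝ ℝ _).smulRight c + ContinuousLinearMap.snd ℝ ℝ _
  have L_apply (z : ℝ × (ι → ℝ)) : L z = z.1 • c + z.2 := rfl
  have inner_h (i : ι) : ⟪h i, k⟫_ℝ = ‖k‖ ^ 2 * c i := by
    rcases eq_or_ne k 0 with rfl | hk
    · simp
    · exact (mul_div_cancel₀ _ (by positivity)).symm
  have inner_r (i : ι) : ⟪k, r i⟫_ℝ = 0 := by
    rw [inner_sub_right, inner_smul_right, real_inner_self_eq_norm_sq, real_inner_comm, inner_h,
      mul_comm, sub_self]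
  have decomposition : ∀ᵐ w ∂A.μ,
      (fun i => A.delta (h i) w) = L (A.delta k w, fun i => A.delta (r i) w) := by
    filter_upwards [ae_all_iff.2 fun i => A.delta_sub_smul (h i) k (c i)] with w delta_r
    ext i
    simp only [L_apply, Pi.add_apply, Pi.smul_apply, smul_eq_mul, r, delta_r]
    ring
  have fderiv_comp_L (w : W) : fderiv ℝ (f ∘ L) (A.delta k w, fun i => A.delta (r i) w) (1, 0) =
      fderiv ℝ f (L (A.delta k w, fun i => A.delta (r i) w)) (L (1, 0)) := by
    rw [fderiv_comp _ (hf.1.differentiable (by simp) _) L.differentiableAt, L.fderiv,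
      ContinuousLinearMap.comp_apply]
  calc ∫ w, A.delta k w * f (fun i => A.delta (h i) w) ∂A.μ
      = ∫ w, A.delta k w * (f ∘ L) (A.delta k w, fun i => A.delta (r i) w) ∂A.μ :=
        integral_congr_ae (decomposition.mono fun w hw => by simp only [hw, Function.comp_apply])
    _ = ‖k‖ ^ 2 * ∫ w, fderiv ℝ (f ∘ L) (A.delta k w, fun i => A.delta (r i) w) (1, 0) ∂A.μ :=
        A.integral_delta_mul_of_inner_eq_zero inner_r (hf.comp L.hasTemperateGrowth)
    _ = ∫ w, fderiv ℝ f (fun i => A.delta (h i) w) (fun i => ⟪h i, k⟫_ℝ) ∂A.μ := by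
        rw [← integral_const_mul]
        refine integral_congr_ae (decomposition.mono fun w hw => ?_)
        have : (fun i => ⟪h i, k⟫_ℝ) = ‖k‖ ^ 2 • L (1, 0) := by
          ext i
          simp [L_apply, inner_h]
        simp only [fderiv_comp_L, hw, this, map_smul, smul_eq_mul]

theorem integral_fderiv_mul (h : ι → H) (p : κ → H) (k : H) {f : (ι → ℝ) → ℝ} {g : (κ → ℝ) → ℝ}
    (hf : f.HasTemperateGrowth) (hg : g.HasTemperateGrowth) :
    ∫ w, fderiv ℝ f (fun i => A.delta (h i) w) (fun i => ⟪h i, k⟫_ℝ) *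
        g (fun j => A.delta (p j) w) ∂A.μ =
      ∫ w, f (fun i => A.delta (h i) w) * (A.delta k w * g (fun j => A.delta (p j) w) -
        fderiv ℝ g (fun j => A.delta (p j) w) (fun j => ⟪p j, k⟫_ℝ)) ∂A.μ := by
  let L : (ι ⊕ κ → ℝ) →L[ℝ] ι → ℝ := ContinuousLinearMap.pi fun i => .proj (.inl i)
  let M : (ι ⊕ κ → ℝ) →L[ℝ] κ → ℝ := ContinuousLinearMap.pi fun j => .proj (.inr j)
  have hfL := hf.comp L.hasTemperateGrowth
  have hgM := hg.comp M.hasTemperateGrowth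
  have fderiv_comp_mul_comp (y c : ι ⊕ κ → ℝ) : fderiv ℝ ((f ∘ L) * (g ∘ M)) y c =
      f (L y) * fderiv ℝ g (M y) (M c) + fderiv ℝ f (L y) (L c) * g (M y) := by
    rw [fderiv_mul (hfL.1.differentiable (by simp) y) (hgM.1.differentiable (by simp) y),
      fderiv_comp _ (hf.1.differentiable (by simp) _) L.differentiableAt,
      fderiv_comp _ (hg.1.differentiable (by simp) _) M.differentiableAt, L.fderiv, M.fderiv]
    simp [mul_comm]
  let X : W → ι → ℝ := fun w i => A.delta (h i) w
  let Y : W → κ → ℝ := fun w j => A.delta (p j) w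
  let F' : W → ℝ := fun w => fderiv ℝ f (X w) fun i => ⟪h i, k⟫_ℝ
  let G' : W → ℝ := fun w => fderiv ℝ g (Y w) fun j => ⟪p j, k⟫_ℝ
  have by_parts : ∫ w, A.delta k w * (f (X w) * g (Y w)) ∂A.μ =
      ∫ w, (f (X w) * G' w + F' w * g (Y w)) ∂A.μ :=
    (A.integral_delta_mul (Sum.elim h p) k (hfL.mul hgM)).trans
      (integral_congr_ae (ae_of_all _ fun w => fderiv_comp_mul_comp _ _))
  have int_fG' : Integrable (fun w => f (X w) * G' w) A.μ :=
    (A.memLp_two_comp_delta h hf).integrable_mul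
      (A.memLp_two_comp_delta p (hasTemperateGrowth_fderiv_apply hg _))
  have int_F'g : Integrable (fun w => F' w * g (Y w)) A.μ :=
    (A.memLp_two_comp_delta h (hasTemperateGrowth_fderiv_apply hf _)).integrable_mul
      (A.memLp_two_comp_delta p hg)
  have int_fg : Integrable (fun w => A.delta k w * (f (X w) * g (Y w))) A.μ :=
    (A.memLp_delta k).integrable_mul (A.memLp_two_comp_delta (Sum.elim h p) (hfL.mul hgM))
  calc ∫ w, F' w * g (Y w) ∂A.μ
      = ∫ w, (A.delta k w * (f (X w) * g (Y w)) - f (X w) * G' w) ∂A.μ := by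
        rw [integral_sub int_fg int_fG', by_parts, integral_add int_fG' int_F'g,
          add_sub_cancel_left]
    _ = ∫ w, f (X w) * (A.delta k w * g (Y w) - G' w) ∂A.μ := by
        congr with w
        ring

end IntegrationByParts

end AbstractWienerSpace

theorem eLpNorm_two_eq_lintegral_rpow {Ω E : Type*} [MeasurableSpace Ω] [NormedAddCommGroup E]
    (f : Ω → E) (μ : Measure Ω) :
    eLpNorm f 2 μ = (∫⁻ w, ‖f w‖ₑ ^ 2 ∂μ) ^ (1 / 2 : ℝ) := by
  rw [eLpNorm_eq_lintegral_rpow_enorm_toReal two_ne_zero ENNReal.ofNat_ne_top, ENNReal.toReal_ofNat]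
  simp only [ENNReal.rpow_two]

section HilbertSchmidt

variable {H X : Type*} [NormedAddCommGroup H] [InnerProductSpace ℝ H]
  [NormedAddCommGroup X] [InnerProductSpace ℝ X]

theorem orthonormal_coe_singleton {v : H} (hv : ‖v‖ = 1) :
    Orthonormal ℝ (fun x : ({v} : Finset H) => (x : H)) := by
  refine ⟨fun x => ?_, fun x y hxy => (hxy (Subsingleton.elim x y)).elim⟩
  exact (congrArg norm (Finset.mem_singleton.1 x.2)).trans hv

theorem enorm_apply_sq_le_hsNormSq (T : H →L[ℝ] X) (k : H) :
    ‖T k‖ₑ ^ 2 ≤ ‖k‖ₑ ^ 2 * hsNormSq T := by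
  rcases eq_or_ne k 0 with rfl | hk
  · simp
  have hv : ‖(‖k‖⁻¹ : ℝ) • k‖ = 1 := norm_smul_inv_norm (𝕜 := ℝ) hk
  have hT : T k = ‖k‖ • T ((‖k‖⁻¹ : ℝ) • k) := by
    rw [← map_smul, smul_inv_smul₀ (norm_ne_zero_iff.2 hk)]
  rw [hT, enorm_smul, enorm_norm, mul_pow]
  gcongr
  refine le_iSup₂_of_le {(‖k‖⁻¹ : ℝ) • k} (orthonormal_coe_singleton hv) ?_
  rw [Finset.sum_singleton]

theorem eLpNorm_apply_le_lintegral_hsNormSq {Ω : Type*} [MeasurableSpace Ω] (μ : Measure Ω)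
    (T : Ω → H →L[ℝ] X) (k : H) :
    eLpNorm (fun w => T w k) 2 μ ≤ (‖k‖ₑ ^ 2 * ∫⁻ w, hsNormSq (T w) ∂μ) ^ (1 / 2 : ℝ) := by
  rw [eLpNorm_two_eq_lintegral_rpow, ← lintegral_const_mul' _ _ (by finiteness)]
  gcongr with w
  exact enorm_apply_sq_le_hsNormSq (T w) k

theorem tendsto_eLpNorm_apply_of_tendsto_lintegral_hsNormSq {Ω : Type*} [MeasurableSpace Ω]
    {μ : Measure Ω} {T : ℕ → Ω → H →L[ℝ] X}
    (hT : Tendsto (fun n => ∫⁻ w, hsNormSq (T n w) ∂μ) atTop (𝓝 0)) (k : H) :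
    Tendsto (fun n => eLpNorm (fun w => T n w k) 2 μ) atTop (𝓝 0) := by
  have h := (ENNReal.Tendsto.const_mul (a := ‖k‖ₑ ^ 2) hT (.inr (by finiteness))).ennrpow_const
    (1 / 2)
  rw [mul_zero, ENNReal.zero_rpow_of_pos (by norm_num)] at h
  exact tendsto_of_tendsto_of_tendsto_of_le_of_le tendsto_const_nhds h (fun _ => zero_le)
    fun n => eLpNorm_apply_le_lintegral_hsNormSq μ (T n) k

end HilbertSchmidt

section

variable {Ω X : Type*} [MeasurableSpace Ω] {μ : Measure Ω}
  [NormedAddCommGroup X] [InnerProductSpace ℝ X]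

theorem memLp_smul_const {p : ℝ≥0∞} {f : Ω → ℝ} (hf : MemLp f p μ) (x : X) :
    MemLp (fun w => f w • x) p μ :=
  (ContinuousLinearMap.toSpanSingleton ℝ x).comp_memLp' hf

theorem integral_inner_sum_smul_sum_smul {ι κ : Type*} [Fintype ι] [Fintype κ]
    {a : ι → Ω → ℝ} {b : κ → Ω → ℝ} (ha : ∀ j, MemLp (a j) 2 μ) (hb : ∀ l, MemLp (b l) 2 μ)
    (x : ι → X) (y : κ → X) :
    ∫ w, ⟪∑ j, a j w • x j, ∑ l, b l w • y l⟫_ℝ ∂μ =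
      ∑ l, ∑ j, (∫ w, a j w * b l w ∂μ) * ⟪x j, y l⟫_ℝ := by
  have integrable_term (j : ι) (l : κ) : Integrable (fun w => a j w * b l w * ⟪x j, y l⟫_ℝ) μ :=
    ((ha j).integrable_mul (hb l)).mul_const _
  simp only [sum_inner, inner_sum, real_inner_smul_left, real_inner_smul_right,
    mul_left_comm (b _ _), ← mul_assoc]
  rw [integral_finsetSum _ fun l _ => integrable_finsetSum _ fun j _ => integrable_term j l]
  refine Finset.sum_congr rfl fun l _ => ?_
  rw [integral_finsetSum _ fun j _ => integrable_term j l]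
  simp only [integral_mul_const]

theorem inner_toLp_two {f g : Ω → X} (hf : MemLp f 2 μ) (hg : MemLp g 2 μ) :
    ⟪hf.toLp f, hg.toLp g⟫_ℝ = ∫ w, ⟪f w, g w⟫_ℝ ∂μ := by
  rw [L2.inner_def]
  refine integral_congr_ae ?_
  filter_upwards [hf.coeFn_toLp, hg.coeFn_toLp] with w hf hg
  rw [hf, hg]

theorem integral_inner_sub_left {f g h : Ω → X} (hf : MemLp f 2 μ) (hg : MemLp g 2 μ)
    (hh : MemLp h 2 μ) :
    ∫ w, ⟪f w - g w, h w⟫_ℝ ∂μ = ∫ w, ⟪f w, h w⟫_ℝ ∂μ - ∫ w, ⟪g w, h w⟫_ℝ ∂μ := by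
  rw [← inner_toLp_two hf hh, ← inner_toLp_two hg hh, ← inner_sub_left, ← MemLp.toLp_sub,
    inner_toLp_two (hf.sub hg) hh]
  rfl

theorem tendsto_integral_inner_of_tendsto_eLpNorm {f : ℕ → Ω → X} {f' g : Ω → X}
    (hf : ∀ n, MemLp (f n) 2 μ) (hf' : MemLp f' 2 μ) (hg : MemLp g 2 μ)
    (h : Tendsto (fun n => eLpNorm (f n - f') 2 μ) atTop (𝓝 0)) :
    Tendsto (fun n => ∫ w, ⟪f n w, g w⟫_ℝ ∂μ) atTop (𝓝 (∫ w, ⟪f' w, g w⟫_ℝ ∂μ)) := by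
  have h := ((Lp.tendsto_Lp_iff_tendsto_eLpNorm'' f hf f' hf').2 h).inner (𝕜 := ℝ)
    (tendsto_const_nhds (x := hg.toLp g))
  simpa only [inner_toLp_two] using h

theorem ae_eq_zero_of_integral_inner_self_eq_zero {f : Ω → X} (hf : MemLp f 2 μ)
    (h : ∫ w, ⟪f w, f w⟫_ℝ ∂μ = 0) : f =ᵐ[μ] 0 := by
  rw [← inner_toLp_two hf hf, inner_self_eq_zero] at h
  exact (hf.toLp_eq_toLp_iff MemLp.zero).1 (h.trans (MemLp.toLp_zero _).symm)

end

namespace SmoothCylinder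

variable {H X : Type*} [NormedAddCommGroup H] [InnerProductSpace ℝ H]

/-- The smooth cylindrical functional `w ↦ (∇F)(w) k`, the derivative of `F` in the direction
`k`. -/
noncomputable def dirDeriv (F : SmoothCylinder H X) (k : H) : SmoothCylinder H X where
  n := F.n
  m := F.m
  dir := F.dir
  coeff j y := fderiv ℝ (F.coeff j) y fun i => ⟪F.dir i, k⟫_ℝ
  temperate j := hasTemperateGrowth_fderiv_apply (F.temperate j) _
  vec := F.vec

end SmoothCylinder

namespace AbstractWienerSpace

section Closability

variable {W H X : Type*} [NormedAddCommGroup W] [NormedSpace ℝ W] [MeasurableSpace W] [BorelSpace W]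
  [NormedAddCommGroup H] [InnerProductSpace ℝ H] [CompleteSpace H]
  [NormedAddCommGroup X] [InnerProductSpace ℝ X]

theorem cylinderGrad_apply (A : AbstractWienerSpace W H) (F : SmoothCylinder H X) (w : W) (k : H) :
    A.cylinderGrad F w k = ∑ j, fderiv ℝ (F.coeff j) (fun i => A.delta (F.dir i) w)
      (fun i => ⟪F.dir i, k⟫_ℝ) • F.vec j := by
  simp only [cylinderGrad, sum_apply, ContinuousLinearMap.smulRight_apply, smul_apply,
    innerSL_apply_apply, smul_eq_mul]
  refine Finset.sum_congr rfl fun j _ => ?_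
  rw [map_eq_sum_smul_map_single]
  simp only [smul_eq_mul, mul_comm]

theorem cylinderEval_dirDeriv (A : AbstractWienerSpace W H) (F : SmoothCylinder H X) (k : H)
    (w : W) : A.cylinderEval (F.dirDeriv k) w = A.cylinderGrad F w k :=
  (A.cylinderGrad_apply F w k).symm

theorem memLp_two_delta_mul_comp_delta (A : AbstractWienerSpace W H) {ι : Type*} [Fintype ι]
    (k : H) (h : ι → H) {f : (ι → ℝ) → ℝ} (hf : f.HasTemperateGrowth) :
    MemLp (fun w => A.delta k w * f fun i => A.delta (h i) w) 2 A.μ := by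
  let fst : (Unit ⊕ ι → ℝ) →L[ℝ] ℝ := .proj (.inl ())
  let snd : (Unit ⊕ ι → ℝ) →L[ℝ] ι → ℝ := .pi fun i => .proj (.inr i)
  exact A.memLp_two_comp_delta (Sum.elim (fun _ => k) h)
    (fst.hasTemperateGrowth.mul (hf.comp snd.hasTemperateGrowth))

theorem memLp_cylinderEval (A : AbstractWienerSpace W H) (F : SmoothCylinder H X) :
    MemLp (A.cylinderEval F) 2 A.μ :=
  memLp_finsetSum _ fun j _ => memLp_smul_const (A.memLp_two_comp_delta F.dir (F.temperate j)) _

theorem memLp_cylinderGrad_apply (A : AbstractWienerSpace W H) (F : SmoothCylinder H X) (k : H) :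
    MemLp (fun w => A.cylinderGrad F w k) 2 A.μ :=
  (A.memLp_cylinderEval (F.dirDeriv k)).ae_eq (ae_of_all _ fun w => A.cylinderEval_dirDeriv F k w)

theorem memLp_delta_smul_cylinderEval (A : AbstractWienerSpace W H) (F : SmoothCylinder H X)
    (k : H) : MemLp (fun w => A.delta k w • A.cylinderEval F w) 2 A.μ := by
  simp only [cylinderEval, Finset.smul_sum, smul_smul]
  exact memLp_finsetSum _ fun j _ =>
    memLp_smul_const (A.memLp_two_delta_mul_comp_delta k F.dir (F.temperate j)) _

theorem integral_inner_cylinderGrad (A : AbstractWienerSpace W H) (F Φ : SmoothCylinder H X)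
    (k : H) : ∫ w, ⟪A.cylinderGrad F w k, A.cylinderEval Φ w⟫_ℝ ∂A.μ =
      ∫ w, ⟪A.cylinderEval F w,
        A.delta k w • A.cylinderEval Φ w - A.cylinderGrad Φ w k⟫_ℝ ∂A.μ := by
  have memLp_coeff (F : SmoothCylinder H X) (j : Fin F.m) :=
    A.memLp_two_comp_delta F.dir (F.temperate j)
  have memLp_deriv (F : SmoothCylinder H X) (j : Fin F.m) :=
    A.memLp_two_comp_delta F.dir
      (hasTemperateGrowth_fderiv_apply (F.temperate j) fun i => ⟪F.dir i, k⟫_ℝ)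
  have memLp_divergence (l : Fin Φ.m) :
      MemLp (fun w => A.delta k w * Φ.coeff l (fun i => A.delta (Φ.dir i) w) -
        fderiv ℝ (Φ.coeff l) (fun i => A.delta (Φ.dir i) w) fun i => ⟪Φ.dir i, k⟫_ℝ) 2 A.μ :=
    (A.memLp_two_delta_mul_comp_delta k Φ.dir (Φ.temperate l)).sub (memLp_deriv Φ l)
  simp only [cylinderGrad_apply, cylinderEval, Finset.smul_sum, smul_smul,
    ← Finset.sum_sub_distrib, ← sub_smul]
  rw [integral_inner_sum_smul_sum_smul (memLp_deriv F) (memLp_coeff Φ),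
    integral_inner_sum_smul_sum_smul (memLp_coeff F) memLp_divergence]
  refine Finset.sum_congr rfl fun l _ => Finset.sum_congr rfl fun j _ => ?_
  exact congrArg (· * _) (A.integral_fderiv_mul F.dir Φ.dir k (F.temperate j) (Φ.temperate l))

variable {A : AbstractWienerSpace W H} {u : W → X} {G G' : W → H →L[ℝ] X}

theorem IsGradient.memLp_apply (hG : A.IsGradient u G) (k : H) :
    MemLp (fun w => G w k) 2 A.μ := by
  refine ⟨hG.aestronglyMeasurable k, (eLpNorm_apply_le_lintegral_hsNormSq A.μ G k).trans_lt ?_⟩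
  have := hG.lintegral_lt_top
  finiteness

theorem IsGradient.integral_inner_cylinderEval (hG : A.IsGradient u G) (Φ : SmoothCylinder H X)
    (k : H) : ∫ w, ⟪G w k, A.cylinderEval Φ w⟫_ℝ ∂A.μ =
      ∫ w, ⟪u w, A.delta k w • A.cylinderEval Φ w - A.cylinderGrad Φ w k⟫_ℝ ∂A.μ := by
  obtain ⟨F, tendsto_eval, tendsto_grad⟩ := hG.exists_approx
  have lim_grad := tendsto_integral_inner_of_tendsto_eLpNorm
    (fun n => A.memLp_cylinderGrad_apply (F n) k) (hG.memLp_apply k) (A.memLp_cylinderEval Φ)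
    (tendsto_eLpNorm_apply_of_tendsto_lintegral_hsNormSq tendsto_grad k)
  have lim_eval := tendsto_integral_inner_of_tendsto_eLpNorm
    (fun n => A.memLp_cylinderEval (F n)) hG.memLp
    ((A.memLp_delta_smul_cylinderEval Φ k).sub (A.memLp_cylinderGrad_apply Φ k)) tendsto_eval
  refine tendsto_nhds_unique lim_grad (lim_eval.congr fun n => ?_)
  exact (A.integral_inner_cylinderGrad (F n) Φ k).symm

theorem IsGradient.integral_inner_sub_eq_zero (hG : A.IsGradient u G) (hG' : A.IsGradient u G')
    (k : H) {G'' : W → H →L[ℝ] X} {u' : W → X} (hG'' : A.IsGradient u' G'') :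
    ∫ w, ⟪G'' w k, G w k - G' w k⟫_ℝ ∂A.μ = 0 := by
  obtain ⟨F, -, tendsto_F⟩ := hG''.exists_approx
  have orthogonal (n : ℕ) : ∫ w, ⟪A.cylinderGrad (F n) w k, G w k - G' w k⟫_ℝ ∂A.μ = 0 := by
    have h := (hG.integral_inner_cylinderEval ((F n).dirDeriv k) k).trans
      (hG'.integral_inner_cylinderEval ((F n).dirDeriv k) k).symm
    simp only [cylinderEval_dirDeriv] at h
    simp only [fun w => real_inner_comm (G w k - G' w k)]
    rw [integral_inner_sub_left (hG.memLp_apply k) (hG'.memLp_apply k)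
      (A.memLp_cylinderGrad_apply (F n) k), h, sub_self]
  have lim := tendsto_integral_inner_of_tendsto_eLpNorm
    (fun n => A.memLp_cylinderGrad_apply (F n) k) (hG''.memLp_apply k)
    ((hG.memLp_apply k).sub (hG'.memLp_apply k))
    (tendsto_eLpNorm_apply_of_tendsto_lintegral_hsNormSq tendsto_F k)
  exact tendsto_nhds_unique lim (tendsto_const_nhds.congr fun n => (orthogonal n).symm)

theorem IsGradient.ae_eq_apply (hG : A.IsGradient u G) (hG' : A.IsGradient u G') (k : H) :
    (fun w => G w k) =ᵐ[A.μ] fun w => G' w k := by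
  have memLp_sub : MemLp (fun w => G w k - G' w k) 2 A.μ :=
    (hG.memLp_apply k).sub (hG'.memLp_apply k)
  have h : ∫ w, ⟪G w k - G' w k, G w k - G' w k⟫_ℝ ∂A.μ = 0 := by
    rw [integral_inner_sub_left (hG.memLp_apply k) (hG'.memLp_apply k) memLp_sub,
      hG.integral_inner_sub_eq_zero hG' k hG, hG.integral_inner_sub_eq_zero hG' k hG', sub_self]
  filter_upwards [ae_eq_zero_of_integral_inner_self_eq_zero memLp_sub h] with w hw
  exact sub_eq_zero.1 hw

theorem IsGradient.ae_eq {ι : Type*} [Countable ι] (e : HilbertBasis ι ℝ H) (hG : A.IsGradient u G)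
    (hG' : A.IsGradient u G') : G =ᵐ[A.μ] G' := by
  filter_upwards [ae_all_iff.2 fun i => hG.ae_eq_apply hG' (e i)] with w hw
  refine ContinuousLinearMap.ext_on (s := Set.range e)
    (Submodule.dense_iff_topologicalClosure_eq_top.2 e.dense_span) ?_
  rintro _ ⟨i, rfl⟩
  exact hw i

end Closability

end AbstractWienerSpace

section OrthonormalSeries

variable {ι H X : Type*} [NormedAddCommGroup H] [InnerProductSpace ℝ H]
  [NormedAddCommGroup X] [InnerProductSpace ℝ X] {b : ι → X} {c : ι → ℝ} {v : X}

theorem summable_norm_sq_iff_tsum_enorm_sq_ne_top {E : Type*} [SeminormedAddCommGroup E]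
    {f : ι → E} : (Summable fun i => ‖f i‖ ^ 2) ↔ ∑' i, ‖f i‖ₑ ^ 2 ≠ ∞ := by
  simp only [enorm_eq_nnnorm, ← ENNReal.coe_pow, ENNReal.tsum_coe_ne_top_iff_summable_coe,
    NNReal.coe_pow, coe_nnnorm]

theorem enorm_sum_smul_sq_of_orthonormal (hb : Orthonormal ℝ b) (c : ι → ℝ) (s : Finset ι) :
    ‖∑ i ∈ s, c i • b i‖ₑ ^ 2 = ∑ i ∈ s, ‖c i‖ₑ ^ 2 := by
  have norm_sq : ‖∑ i ∈ s, c i • b i‖ ^ 2 = ∑ i ∈ s, ‖c i‖ ^ 2 :=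
    hb.orthogonalFamily.norm_sum (V := fun i => LinearIsometry.toSpanSingleton ℝ X (hb.1 i)) c s
  simp only [← ofReal_norm, ← ENNReal.ofReal_pow (norm_nonneg _)]
  rw [norm_sq, ENNReal.ofReal_sum_of_nonneg fun _ _ => sq_nonneg _]

theorem enorm_sq_eq_tsum_of_hasSum_smul (hb : Orthonormal ℝ b)
    (hv : HasSum (fun i => c i • b i) v) : ‖v‖ₑ ^ 2 = ∑' i, ‖c i‖ₑ ^ 2 := by
  have h := (ENNReal.continuous_pow 2).continuousAt.tendsto.comp hv.enorm
  refine tendsto_nhds_unique h (ENNReal.summable.hasSum.congr fun s => ?_)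
  exact (enorm_sum_smul_sq_of_orthonormal hb c s).symm

theorem enorm_sum_range_sub_sq_of_hasSum_smul {b : ℕ → X} {c : ℕ → ℝ} (hb : Orthonormal ℝ b)
    (hv : HasSum (fun i => c i • b i) v) (n : ℕ) :
    ‖∑ i ∈ Finset.range n, c i • b i - v‖ₑ ^ 2 = ∑' i, ‖c (i + n)‖ₑ ^ 2 := by
  rw [← enorm_neg, neg_sub]
  exact enorm_sq_eq_tsum_of_hasSum_smul (hb.comp (· + n) (add_left_injective n))
    ((hasSum_nat_add_iff' n).2 hv)

theorem inner_eq_of_hasSum_smul (hb : Orthonormal ℝ b) (hv : HasSum (fun i => c i • b i) v)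
    (i : ι) : ⟪b i, v⟫_ℝ = c i := by
  have term_eq (j : ι) (hj : j ≠ i) : innerSL ℝ (b i) (c j • b j) = 0 := by
    rw [innerSL_apply_apply, real_inner_smul_right, hb.2 hj.symm, mul_zero]
  rw [← innerSL_apply_apply (𝕜 := ℝ), (hv.mapL (innerSL ℝ (b i))).unique (hasSum_single i term_eq),
    innerSL_apply_apply, real_inner_smul_right, real_inner_self_eq_norm_sq, hb.1, one_pow, mul_one]

theorem summable_smul_iff_of_orthonormal [CompleteSpace X] (hb : Orthonormal ℝ b) :
    (Summable fun i => c i • b i) ↔ Summable fun i => ‖c i‖ ^ 2 :=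
  hb.orthogonalFamily.summable_iff_norm_sq_summable c

theorem exists_hasSum_inner_smul [Countable ι] [CompleteSpace H] [CompleteSpace X]
    (hb : Orthonormal ℝ b) {y : ι → H} (hy : Summable fun i => ‖y i‖ ^ 2) :
    ∃ T : H →L[ℝ] X, ∀ x, HasSum (fun i => ⟪y i, x⟫_ℝ • b i) (T x) := by
  have summable (x : H) : Summable fun i => ⟪y i, x⟫_ℝ • b i := by
    rw [summable_smul_iff_of_orthonormal hb]
    refine (hy.mul_right (‖x‖ ^ 2)).of_nonneg_of_le (fun _ => sq_nonneg _) fun i => ?_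
    rw [← mul_pow]
    gcongr
    exact norm_inner_le_norm _ _
  refine ⟨continuousLinearMapOfTendsto (l := atTop)
    (fun s : Finset ι => ∑ i ∈ s, (innerSL ℝ (y i)).smulRight (b i))
    (f := fun x => ∑' i, ⟪y i, x⟫_ℝ • b i) (tendsto_pi_nhds.2 fun x => ?_),
    fun x => (summable x).hasSum⟩
  simpa [HasSum] using (summable x).hasSum

theorem hsNormSq_le_tsum_enorm_sq (hb : Orthonormal ℝ b) {y : ι → H} {T : H →L[ℝ] X}
    (hT : ∀ x, HasSum (fun i => ⟪y i, x⟫_ℝ • b i) (T x)) : hsNormSq T ≤ ∑' i, ‖y i‖ₑ ^ 2 := by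
  refine iSup₂_le fun s hs => ?_
  have bessel (z : H) : ∑ x ∈ s, ‖⟪z, x⟫_ℝ‖ₑ ^ 2 ≤ ‖z‖ₑ ^ 2 := by
    have h := hs.sum_inner_products_le (s := Finset.univ) z
    rw [Finset.univ_eq_attach, Finset.sum_attach s fun x => ‖⟪x, z⟫_ℝ‖ ^ 2] at h
    simp only [← ofReal_norm, ← ENNReal.ofReal_pow (norm_nonneg _), real_inner_comm _ z]
    rw [← ENNReal.ofReal_sum_of_nonneg fun _ _ => sq_nonneg _]
    exact ENNReal.ofReal_le_ofReal h
  calc ∑ x ∈ s, ‖T x‖ₑ ^ 2 = ∑ x ∈ s, ∑' i, ‖⟪y i, x⟫_ℝ‖ₑ ^ 2 :=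
        Finset.sum_congr rfl fun x _ => enorm_sq_eq_tsum_of_hasSum_smul hb (hT x)
    _ = ∑' i, ∑ x ∈ s, ‖⟪y i, x⟫_ℝ‖ₑ ^ 2 :=
        (Summable.tsum_finsetSum fun _ _ => ENNReal.summable).symm
    _ ≤ ∑' i, ‖y i‖ₑ ^ 2 := ENNReal.tsum_le_tsum fun i => bessel (y i)

end OrthonormalSeries

namespace AbstractWienerSpace

section GaussianSeries

variable {W H X : Type*} [NormedAddCommGroup W] [NormedSpace ℝ W] [MeasurableSpace W] [BorelSpace W]
  [NormedAddCommGroup H] [InnerProductSpace ℝ H] [CompleteSpace H]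
  [NormedAddCommGroup X] [InnerProductSpace ℝ X] (A : AbstractWienerSpace W H)

theorem lintegral_enorm_delta_sq (h : H) : ∫⁻ w, ‖A.delta h w‖ₑ ^ 2 ∂A.μ = ‖h‖ₑ ^ 2 := by
  have h_eLpNorm : ‖h‖ₑ = eLpNorm (A.delta h) 2 A.μ := by
    rw [← Lp.enorm_def, ← ofReal_norm, ← ofReal_norm, A.norm_delta]
  rw [h_eLpNorm, eLpNorm_two_eq_lintegral_rpow, ← ENNReal.rpow_two, ← ENNReal.rpow_mul]
  norm_num

theorem lintegral_tsum_enorm_delta_sq {ι : Type*} [Countable ι] (y : ι → H) :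
    ∫⁻ w, ∑' i, ‖A.delta (y i) w‖ₑ ^ 2 ∂A.μ = ∑' i, ‖y i‖ₑ ^ 2 := by
  rw [lintegral_tsum fun i => ((A.measurable_delta (y i)).enorm.pow_const 2).aemeasurable]
  simp only [lintegral_enorm_delta_sq]

theorem ae_summable_delta_smul [CompleteSpace X] {ι : Type*} [Countable ι] {b : ι → X}
    (hb : Orthonormal ℝ b) {y : ι → H} (hy : Summable fun i => ‖y i‖ ^ 2) :
    ∀ᵐ w ∂A.μ, Summable fun i => A.delta (y i) w • b i := by
  simp only [summable_smul_iff_of_orthonormal hb]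
  rw [summable_norm_sq_iff_tsum_enorm_sq_ne_top, ← A.lintegral_tsum_enorm_delta_sq] at hy
  filter_upwards [ae_lt_top' (AEMeasurable.tsum fun i =>
    ((A.measurable_delta (y i)).enorm.pow_const 2).aemeasurable) hy] with w hw
  exact summable_norm_sq_iff_tsum_enorm_sq_ne_top.2 hw.ne

/-- The smooth cylindrical functional `∑_{i < n} δ(y_i) b_i`, a partial sum of a Gaussian series. -/
noncomputable def gaussianPartialSum (y : ℕ → H) (b : ℕ → X) (n : ℕ) : SmoothCylinder H X where
  n := n
  m := n
  dir i := y i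
  coeff j x := x j
  temperate j := (ContinuousLinearMap.proj (R := ℝ) (φ := fun _ : Fin n => ℝ) j).hasTemperateGrowth
  vec j := b j

theorem cylinderEval_gaussianPartialSum (y : ℕ → H) (b : ℕ → X) (n : ℕ) (w : W) :
    A.cylinderEval (gaussianPartialSum y b n) w = ∑ i ∈ Finset.range n, A.delta (y i) w • b i :=
  Fin.sum_univ_eq_sum_range (fun i => A.delta (y i) w • b i) n

theorem cylinderGrad_gaussianPartialSum (y : ℕ → H) (b : ℕ → X) (n : ℕ) (w : W) (x : H) :
    A.cylinderGrad (gaussianPartialSum y b n) w x = ∑ i ∈ Finset.range n, ⟪y i, x⟫_ℝ • b i := by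
  rw [cylinderGrad_apply, ← Fin.sum_univ_eq_sum_range (fun i => ⟪y i, x⟫_ℝ • b i)]
  refine Finset.sum_congr rfl fun (j : Fin n) _ => congrArg (· • b j) ?_
  exact DFunLike.congr_fun
    (ContinuousLinearMap.proj (R := ℝ) (φ := fun _ : Fin n => ℝ) j).fderiv _

variable {A} {b : ℕ → X} {y : ℕ → H} {u : W → X} {T : H →L[ℝ] X}

theorem hsNormSq_cylinderGrad_gaussianPartialSum_sub_le (hb : Orthonormal ℝ b)
    (hT : ∀ x, HasSum (fun i => ⟪y i, x⟫_ℝ • b i) (T x)) (n : ℕ) (w : W) :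
    hsNormSq (A.cylinderGrad (gaussianPartialSum y b n) w - T) ≤ ∑' i, ‖y (i + n)‖ₑ ^ 2 := by
  have h := hsNormSq_le_tsum_enorm_sq (hb.comp (· + n) (add_left_injective n))
    (y := fun i => -y (i + n)) (T := A.cylinderGrad (gaussianPartialSum y b n) w - T) fun x => ?_
  · simpa only [enorm_neg] using h
  · simp only [inner_neg_left, neg_smul, Function.comp_apply, sub_apply,
      cylinderGrad_gaussianPartialSum]
    rw [← neg_sub]
    exact ((hasSum_nat_add_iff' n).2 (hT x)).neg

theorem eLpNorm_gaussianPartialSum_sub (hb : Orthonormal ℝ b)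
    (hu : ∀ᵐ w ∂A.μ, HasSum (fun i => A.delta (y i) w • b i) (u w)) (n : ℕ) :
    eLpNorm (fun w => A.cylinderEval (gaussianPartialSum y b n) w - u w) 2 A.μ =
      (∑' i, ‖y (i + n)‖ₑ ^ 2) ^ (1 / 2 : ℝ) := by
  rw [eLpNorm_two_eq_lintegral_rpow, ← A.lintegral_tsum_enorm_delta_sq]
  congr 1
  refine lintegral_congr_ae ?_
  filter_upwards [hu] with w hw
  rw [cylinderEval_gaussianPartialSum, enorm_sum_range_sub_sq_of_hasSum_smul hb hw]

theorem aestronglyMeasurable_of_ae_hasSum_delta_smul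
    (hu : ∀ᵐ w ∂A.μ, HasSum (fun i => A.delta (y i) w • b i) (u w)) :
    AEStronglyMeasurable u A.μ := by
  refine aestronglyMeasurable_of_tendsto_ae atTop
    (fun n => (A.memLp_cylinderEval (gaussianPartialSum y b n)).1) ?_
  filter_upwards [hu] with w hw
  simpa only [cylinderEval_gaussianPartialSum] using hw.tendsto_sum_nat

theorem isGradient_of_ae_hasSum_delta_smul (hb : Orthonormal ℝ b)
    (hy : Summable fun i => ‖y i‖ ^ 2)
    (hu : ∀ᵐ w ∂A.μ, HasSum (fun i => A.delta (y i) w • b i) (u w))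
    (hT : ∀ x, HasSum (fun i => ⟪y i, x⟫_ℝ • b i) (T x)) : A.IsGradient u fun _ => T := by
  rw [summable_norm_sq_iff_tsum_enorm_sq_ne_top] at hy
  have tail_tendsto : Tendsto (fun n => ∑' i, ‖y (i + n)‖ₑ ^ 2) atTop (𝓝 0) :=
    ENNReal.tendsto_sum_nat_add _ hy
  have memLp_u : MemLp u 2 A.μ := by
    refine ⟨aestronglyMeasurable_of_ae_hasSum_delta_smul hu, ?_⟩
    have h := eLpNorm_gaussianPartialSum_sub hb hu 0
    simp only [cylinderEval_gaussianPartialSum, Finset.range_zero, Finset.sum_empty, zero_sub,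
      add_zero] at h
    rw [← eLpNorm_neg]
    exact h.trans_lt (by finiteness)
  refine ⟨memLp_u, fun _ => aestronglyMeasurable_const, ?_, gaussianPartialSum y b, ?_, ?_⟩
  · rw [lintegral_const, measure_univ, mul_one]
    exact (hsNormSq_le_tsum_enorm_sq hb hT).trans_lt hy.lt_top
  · simp only [eLpNorm_gaussianPartialSum_sub hb hu]
    simpa using tail_tendsto.ennrpow_const (1 / 2)
  · refine tendsto_of_tendsto_of_tendsto_of_le_of_le tendsto_const_nhds tail_tendsto
      (fun _ => zero_le) fun n => ?_
    refine (lintegral_mono fun w =>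
      hsNormSq_cylinderGrad_gaussianPartialSum_sub_le hb hT n w).trans_eq ?_
    rw [lintegral_const, measure_univ, mul_one]

theorem inner_ae_eq_delta_adjoint [CompleteSpace X] (b : HilbertBasis ℕ ℝ X)
    (hu : ∀ᵐ w ∂A.μ, HasSum (fun i => A.delta (y i) w • b i) (u w))
    (hT : ∀ x, HasSum (fun i => ⟪y i, x⟫_ℝ • b i) (T x)) (x : X) :
    (fun w => ⟪u w, x⟫_ℝ) =ᵐ[A.μ] A.delta (T.adjoint x) := by
  have adjoint_apply_basis (i : ℕ) : T.adjoint (b i) = y i := by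
    refine ext_inner_right ℝ fun z => ?_
    rw [ContinuousLinearMap.adjoint_inner_left, inner_eq_of_hasSum_smul b.orthonormal (hT z)]
  have hasSum_adjoint : HasSum (fun i => ⟪b i, x⟫_ℝ • y i) (T.adjoint x) := by
    simpa only [map_smul, b.repr_apply_apply, adjoint_apply_basis]
      using (b.hasSum_repr x).mapL T.adjoint
  have tendsto_Lp :=
    (A.delta.continuous.tendsto (T.adjoint x)).comp hasSum_adjoint.tendsto_sum_nat
  refine tendstoInMeasure_ae_unique (u := atTop)
    (tendstoInMeasure_of_tendsto_ae (fun n => (Lp.aestronglyMeasurable _)) ?_)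
    (tendstoInMeasure_of_tendsto_Lp tendsto_Lp)
  filter_upwards [hu, ae_all_iff.2 fun n => A.delta_sum (Finset.range n)
    (fun i => ⟪b i, x⟫_ℝ) y] with w hw sum_eq
  simp only [Function.comp_apply, sum_eq]
  have h := (hw.mapL (innerSL ℝ x)).tendsto_sum_nat
  simpa only [innerSL_apply_apply, real_inner_smul_right, real_inner_comm x, mul_comm] using h

end GaussianSeries

end AbstractWienerSpace

theorem nonpos_of_le_one_add_mul_succ {T ε : ℕ → ℝ} (hε : Summable ε) (hε0 : ∀ m, 0 ≤ ε m)
    (hstep : ∀ m, T m ≤ (1 + ε m) * T (m + 1)) (hT : Tendsto T atTop (𝓝 0)) : T 0 ≤ 0 := by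
  have le_prod (m : ℕ) : T 0 ≤ (∏ k ∈ Finset.range m, (1 + ε k)) * T m := by
    induction m with
    | zero => simp
    | succ m ih =>
      rw [Finset.prod_range_succ, mul_assoc]
      exact ih.trans (mul_le_mul_of_nonneg_left (hstep m)
        (Finset.prod_nonneg fun k _ => add_nonneg zero_le_one (hε0 k)))
  have prod_tendsto := (Real.multipliable_one_add_of_summable hε).hasProd.tendsto_prod_nat
  simpa only [mul_zero] using ge_of_tendsto' (prod_tendsto.mul hT) le_prod

theorem tendsto_prod_range_rpow_of_tendsto_zero {a : ℕ → ℝ} (ha0 : ∀ i, 0 ≤ a i)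
    (ha : Tendsto a atTop (𝓝 0)) :
    Tendsto (fun n : ℕ => (∏ j ∈ Finset.range n, a j) ^ (1 / (n : ℝ))) atTop (𝓝 0) := by
  have prod_nonneg (n : ℕ) : 0 ≤ ∏ j ∈ Finset.range n, a j :=
    Finset.prod_nonneg fun j _ => ha0 j
  refine squeeze_zero' (.of_forall fun n => Real.rpow_nonneg (prod_nonneg n) _) ?_ ha.cesaro
  filter_upwards [eventually_gt_atTop 0] with n hn
  have amgm := Real.geom_mean_le_arith_mean (Finset.range n) (fun _ => 1) a
    (fun _ _ => zero_le_one) (by simpa using hn) fun j _ => ha0 j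
  simpa [div_eq_inv_mul] using amgm

theorem abs_mul_infDist_le_norm_sub_smul {E : Type*} [NormedAddCommGroup E]
    [NormedSpace ℝ E] (K : Submodule ℝ E) (v : E) (c : ℝ) {y : E} (hy : y ∈ K) :
    |c| * Metric.infDist v K ≤ ‖y - c • v‖ := by
  rcases eq_or_ne c 0 with rfl | hc
  · simp
  have dist_le := Metric.infDist_le_dist_of_mem (x := v) (K.smul_mem c⁻¹ hy)
  calc |c| * Metric.infDist v K ≤ ‖c‖ * ‖v - c⁻¹ • y‖ := by
        rw [← dist_eq_norm v, Real.norm_eq_abs]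
        gcongr
    _ = ‖y - c • v‖ := by rw [← norm_smul, smul_sub, smul_inv_smul₀ hc, norm_sub_rev]

namespace ContinuousResolution

variable {H : Type*} [NormedAddCommGroup H] [InnerProductSpace ℝ H] [CompleteSpace H]
  (π : ContinuousResolution H) (θ : Set.Icc (0 : ℝ) 1)

theorem proj_proj (x : H) : π.proj θ (π.proj θ x) = π.proj θ x :=
  DFunLike.congr_fun (π.isStarProjection θ).isIdempotentElem x

theorem inner_proj_left (x y : H) : ⟪π.proj θ x, y⟫_ℝ = ⟪x, π.proj θ y⟫_ℝ :=
  (π.isStarProjection θ).isSelfAdjoint.isSymmetric x y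

end ContinuousResolution

section WeightedShift

variable {H : Type*} [NormedAddCommGroup H] [InnerProductSpace ℝ H]

theorem hasSum_sq_inner_of_hilbertBasis {ι : Type*} (e : HilbertBasis ι ℝ H) (x : H) :
    HasSum (fun i => ⟪e i, x⟫_ℝ ^ 2) (‖x‖ ^ 2) := by
  simpa only [sq, real_inner_comm, real_inner_self_eq_norm_mul_norm] using
    e.hasSum_inner_mul_inner x x

/-- The squared distance from `x` to the span of `e 0, …, e (m - 1)`, as the tail of the series
`‖x‖ ^ 2 = ∑ ⟪e i, x⟫ ^ 2`. -/
noncomputable def tailNormSq (e : HilbertBasis ℕ ℝ H) (x : H) (m : ℕ) : ℝ :=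
  ∑' i, ⟪e (i + m), x⟫_ℝ ^ 2

/-- The operator `x ↦ ∑ aᵢ ⟪e (i + 1), x⟫ e i`. -/
def IsWeightedBackwardShift (e : HilbertBasis ℕ ℝ H) (a : ℕ → ℝ) (B : H →L[ℝ] H) : Prop :=
  ∀ x, HasSum (fun i => (a i * ⟪e (i + 1), x⟫_ℝ) • e i) (B x)

variable (e : HilbertBasis ℕ ℝ H)

theorem summable_sq_inner_add (x : H) (m : ℕ) : Summable fun i => ⟪e (i + m), x⟫_ℝ ^ 2 :=
  (summable_nat_add_iff m).2 (hasSum_sq_inner_of_hilbertBasis e x).summable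

theorem tailNormSq_zero (x : H) : tailNormSq e x 0 = ‖x‖ ^ 2 :=
  (hasSum_sq_inner_of_hilbertBasis e x).tsum_eq

theorem tailNormSq_eq_add_succ (x : H) (m : ℕ) :
    tailNormSq e x m = ⟪e m, x⟫_ℝ ^ 2 + tailNormSq e x (m + 1) := by
  simpa only [tailNormSq, zero_add, add_assoc, add_comm 1 m] using
    (summable_sq_inner_add e x m).tsum_eq_zero_add

theorem tailNormSq_le_norm_sq (x : H) (m : ℕ) : tailNormSq e x m ≤ ‖x‖ ^ 2 := by
  induction m with
  | zero => exact (tailNormSq_zero e x).le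
  | succ m ih => nlinarith [tailNormSq_eq_add_succ e x m, sq_nonneg ⟪e m, x⟫_ℝ]

theorem tendsto_tailNormSq (x : H) : Tendsto (tailNormSq e x) atTop (𝓝 0) :=
  tendsto_sum_nat_add fun i => ⟪e i, x⟫_ℝ ^ 2

theorem tailNormSq_le_mul_tailNormSq {x z : H} {m n : ℕ} {c : ℝ}
    (h : ∀ i, |⟪e (i + m), z⟫_ℝ| ≤ c * |⟪e (i + n), x⟫_ℝ|) :
    tailNormSq e z m ≤ c ^ 2 * tailNormSq e x n := by
  rw [tailNormSq, tailNormSq, ← tsum_mul_left]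
  refine (summable_sq_inner_add e z m).tsum_le_tsum (fun i => ?_)
    ((summable_sq_inner_add e x n).mul_left _)
  rw [← sq_abs, ← sq_abs ⟪e (i + n), x⟫_ℝ, ← mul_pow]
  exact pow_le_pow_left₀ (abs_nonneg _) (h i) 2

theorem summable_norm_sq_smul_succ {a : ℕ → ℝ} (hsum : Summable fun i => a i ^ 2) :
    Summable fun i => ‖a i • e (i + 1)‖ ^ 2 := by
  simpa only [norm_smul, e.orthonormal.1, mul_one, Real.norm_eq_abs, sq_abs] using hsum

theorem exists_isWeightedBackwardShift [CompleteSpace H] {a : ℕ → ℝ}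
    (hsum : Summable fun i => a i ^ 2) :
    ∃ B, IsWeightedBackwardShift e a B := by
  simpa only [IsWeightedBackwardShift, real_inner_smul_left] using
    exists_hasSum_inner_smul e.orthonormal (summable_norm_sq_smul_succ e hsum)

namespace IsWeightedBackwardShift

variable {e} {a : ℕ → ℝ} {B : H →L[ℝ] H}

theorem hasSum_inner_smul (hB : IsWeightedBackwardShift e a B) (x : H) :
    HasSum (fun i => ⟪a i • e (i + 1), x⟫_ℝ • e i) (B x) := by
  simpa only [real_inner_smul_left] using hB x

theorem inner_apply (hB : IsWeightedBackwardShift e a B) (i : ℕ) (x : H) :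
    ⟪e i, B x⟫_ℝ = a i * ⟪e (i + 1), x⟫_ℝ :=
  inner_eq_of_hasSum_smul e.orthonormal (hB x) i

theorem inner_pow_apply (hB : IsWeightedBackwardShift e a B) (m i : ℕ) (x : H) :
    ⟪e i, (B ^ m) x⟫_ℝ = (∏ j ∈ Finset.range m, a (i + j)) * ⟪e (i + m), x⟫_ℝ := by
  induction m generalizing i with
  | zero => simp
  | succ m ih =>
    rw [pow_succ', mul_apply_eq_comp, hB.inner_apply, ih, Finset.prod_range_succ']
    simp only [add_zero, add_assoc, add_comm 1]
    ring

theorem norm_pow_le (hB : IsWeightedBackwardShift e a B) (ha : Antitone a) (ha0 : ∀ i, 0 ≤ a i)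
    (m : ℕ) : ‖B ^ m‖ ≤ ∏ j ∈ Finset.range m, a j := by
  have prod_nonneg : 0 ≤ ∏ j ∈ Finset.range m, a j := Finset.prod_nonneg fun j _ => ha0 j
  refine (B ^ m).opNorm_le_bound prod_nonneg fun x => ?_
  refine (sq_le_sq₀ (norm_nonneg _) (by positivity)).1 ?_
  rw [mul_pow, ← tailNormSq_zero e]
  refine (tailNormSq_le_mul_tailNormSq e fun i => ?_).trans
    (mul_le_mul_of_nonneg_left (tailNormSq_le_norm_sq e x m) (sq_nonneg _))
  rw [add_zero, hB.inner_pow_apply, abs_mul, abs_of_nonneg (Finset.prod_nonneg fun j _ => ha0 _)]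
  gcongr with j
  · exact fun j _ => ha0 _
  · exact ha (Nat.le_add_left j i)

theorem isQuasinilpotent (hB : IsWeightedBackwardShift e a B) (ha : Antitone a)
    (ha0 : ∀ i, 0 ≤ a i) (hsum : Summable fun i => a i ^ 2) : IsQuasinilpotent B := by
  refine ⟨(hsNormSq_le_tsum_enorm_sq e.orthonormal hB.hasSum_inner_smul).trans_lt
    (summable_norm_sq_iff_tsum_enorm_sq_ne_top.1 (summable_norm_sq_smul_succ e hsum)).lt_top, ?_⟩
  have tendsto_zero : Tendsto a atTop (𝓝 0) := by
    simpa [Real.sqrt_sq, ha0] using hsum.tendsto_atTop_zero.sqrt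
  refine squeeze_zero (fun n => by positivity) (fun n => ?_)
    (tendsto_prod_range_rpow_of_tendsto_zero ha0 tendsto_zero)
  exact Real.rpow_le_rpow (norm_nonneg _) (hB.norm_pow_le ha ha0 n) (by positivity)

/-- Rescaled so that its `e 0`-coordinate is `⟪e m, x⟫`, the vector `B ^ m x` is `⟪e m, x⟫ • e 0` up
to a relative error of size `a m`. -/
theorem norm_sub_smul_sq_le (hB : IsWeightedBackwardShift e a B) (ha : Antitone a)
    (ha0 : ∀ i, 0 < a i) (m : ℕ) (x : H) :
    ‖(∏ j ∈ Finset.range m, a j)⁻¹ • (B ^ m) x - ⟪e m, x⟫_ℝ • e 0‖ ^ 2 ≤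
      (a m / a 0) ^ 2 * tailNormSq e x (m + 1) := by
  set p := ∏ j ∈ Finset.range m, a j with hp
  set z := p⁻¹ • (B ^ m) x - ⟪e m, x⟫_ℝ • e 0
  have p_pos : 0 < p := Finset.prod_pos fun j _ => ha0 j
  have inner_z (i : ℕ) : ⟪e i, z⟫_ℝ =
      p⁻¹ * ((∏ j ∈ Finset.range m, a (i + j)) * ⟪e (i + m), x⟫_ℝ) -
        ⟪e m, x⟫_ℝ * ⟪e i, e 0⟫_ℝ := by
    rw [inner_sub_right, real_inner_smul_right, real_inner_smul_right, hB.inner_pow_apply]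
  have inner_zero : ⟪e 0, z⟫_ℝ = 0 := by
    simp only [inner_z, zero_add, ← hp, inv_mul_cancel_left₀ p_pos.ne', e.orthonormal.1,
      real_inner_self_eq_norm_sq, one_pow, mul_one, sub_self]
  have prod_succ_le (i : ℕ) : ∏ j ∈ Finset.range m, a (i + 1 + j) ≤ p * (a m / a 0) := by
    rw [hp, ← mul_div_assoc, ← Finset.prod_range_succ, Finset.prod_range_succ',
      mul_div_cancel_right₀ _ (ha0 0).ne']
    exact Finset.prod_le_prod (fun j _ => (ha0 _).le) fun j _ => ha (by lia)
  rw [← tailNormSq_zero e, tailNormSq_eq_add_succ, inner_zero, zero_pow two_ne_zero, zero_add]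
  refine tailNormSq_le_mul_tailNormSq e fun i => ?_
  rw [inner_z, e.orthonormal.2 (Nat.succ_ne_zero i), mul_zero, sub_zero, abs_mul, abs_mul,
    abs_of_pos (inv_pos.2 p_pos), abs_of_pos (Finset.prod_pos fun j _ => ha0 _), ← mul_assoc,
    add_assoc i, add_comm 1 m]
  gcongr
  exact (inv_mul_le_iff₀ p_pos).2 (prod_succ_le i)

theorem eq_bot_of_isClosed_of_notMem (hB : IsWeightedBackwardShift e a B) (ha : Antitone a)
    (ha0 : ∀ i, 0 < a i) (hsum : Summable fun i => a i ^ 2) {K : Submodule ℝ H}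
    (hK : IsClosed (K : Set H)) (hBK : ∀ x ∈ K, B x ∈ K) (he : e 0 ∉ K) : K = ⊥ := by
  refine (Submodule.eq_bot_iff K).2 fun x hx => ?_
  have dist_pos : 0 < Metric.infDist (e 0) K := (hK.notMem_iff_infDist_pos K.nonempty).1 he
  have pow_mem (m : ℕ) : (B ^ m) x ∈ K := by
    induction m with
    | zero => simpa using hx
    | succ m ih => rw [pow_succ']; exact hBK _ ih
  have inner_sq_le (m : ℕ) : ⟪e m, x⟫_ℝ ^ 2 ≤
      (a m / a 0) ^ 2 / Metric.infDist (e 0) K ^ 2 * tailNormSq e x (m + 1) := by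
    rw [div_mul_eq_mul_div, le_div_iff₀ (by positivity), ← sq_abs, ← mul_pow]
    exact (pow_le_pow_left₀ (by positivity) (abs_mul_infDist_le_norm_sub_smul K _ _
      (K.smul_mem _ (pow_mem m))) 2).trans (hB.norm_sub_smul_sq_le ha ha0 m x)
  have tail_nonpos : tailNormSq e x 0 ≤ 0 := by
    refine nonpos_of_le_one_add_mul_succ
      (ε := fun m => (a m / a 0) ^ 2 / Metric.infDist (e 0) K ^ 2) ?_ (fun m => by positivity)
      (fun m => ?_) (tendsto_tailNormSq e x)
    · simpa only [div_pow] using (hsum.div_const _).div_const _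
    · rw [tailNormSq_eq_add_succ, one_add_mul, add_comm]
      exact add_le_add_right (inner_sq_le m) _
  rw [tailNormSq_zero] at tail_nonpos
  simpa using le_antisymm tail_nonpos (sq_nonneg _)

/-- By continuity some `π_θ` maps `e 0` to a vector of norm `1 / 2`; its kernel is neither `⊥` nor
does it contain `e 0`. -/
theorem not_forall_mem_ker [CompleteSpace H] (hB : IsWeightedBackwardShift e a B)
    (ha : Antitone a) (ha0 : ∀ i, 0 < a i) (hsum : Summable fun i => a i ^ 2)
    (π : ContinuousResolution H) : ¬ ∀ θ x, π.proj θ x = 0 → π.proj θ (B x) = 0 := by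
  intro invariant
  obtain ⟨θ, hθ⟩ : ∃ θ, ‖π.proj θ (e 0)‖ = 1 / 2 := by
    refine mem_range_of_exists_le_of_exists_ge (π.continuous_apply (e 0)).norm ⟨0, ?_⟩ ⟨1, ?_⟩
    · simp [π.proj_zero]
    · simpa [π.proj_one, e.orthonormal.1] using two_inv_lt_one.le
  have notMem : e 0 ∉ (π.proj θ).ker := fun h => by
    rw [LinearMap.mem_ker] at h
    norm_num [show π.proj θ (e 0) = 0 from h] at hθ
  have ker_eq_bot := hB.eq_bot_of_isClosed_of_notMem ha ha0 hsum
    (π.proj θ).isClosed_ker (invariant θ) notMem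
  have fixed : π.proj θ (e 0) = e 0 := LinearMap.ker_eq_bot.1 ker_eq_bot (π.proj_proj θ (e 0))
  norm_num [fixed, e.orthonormal.1] at hθ

end IsWeightedBackwardShift

end WeightedShift

namespace AbstractWienerSpace

variable {W H : Type*} [NormedAddCommGroup W] [NormedSpace ℝ W] [MeasurableSpace W] [BorelSpace W]
  [NormedAddCommGroup H] [InnerProductSpace ℝ H] [CompleteSpace H] (A : AbstractWienerSpace W H)

theorem eq_zero_of_aestronglyMeasurable_delta_comap {S : Type*} {f : S → H} {y : H}
    (hfy : ∀ s, ⟪f s, y⟫_ℝ = 0)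
    (hy : AEStronglyMeasurable[MeasurableSpace.comap (fun w s => A.delta (f s) w)
      MeasurableSpace.pi] (A.delta y) A.μ) : y = 0 := by
  obtain ⟨g, g_meas, delta_eq_g⟩ := hy
  have indep : IndepFun (fun w s => A.delta (f s) w) (A.delta y) A.μ :=
    (A.indepFun_delta_of_inner_eq_zero f (fun _ : Unit => y) fun s _ => hfy s).comp
      measurable_id (measurable_pi_apply ())
  have indep_g : IndepFun g (A.delta y) A.μ := by
    rw [IndepFun_iff_Indep] at indep ⊢
    exact indep_of_indep_of_le_left indep g_meas.measurable.comap_le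
  have g_aesm : AEStronglyMeasurable g A.μ := (A.memLp_delta y).1.congr delta_eq_g
  rw [← inner_self_eq_zero (𝕜 := ℝ), ← A.integral_delta_mul_delta]
  calc ∫ w, A.delta y w * A.delta y w ∂A.μ = ∫ w, g w * A.delta y w ∂A.μ :=
        integral_congr_ae (delta_eq_g.mono fun w hw => congrArg (· * A.delta y w) hw)
    _ = (∫ w, g w ∂A.μ) * ∫ w, A.delta y w ∂A.μ :=
        indep_g.integral_fun_mul_eq_mul_integral g_aesm (A.memLp_delta y).1
    _ = 0 := by rw [A.integral_delta, mul_zero]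

variable (π : ContinuousResolution H)

theorem filtration_eq_comap (θ : Set.Icc (0 : ℝ) 1) :
    A.filtration π θ = MeasurableSpace.comap (fun w h => A.delta (π.proj θ h) w)
      MeasurableSpace.pi := by
  simp only [filtration, MeasurableSpace.pi, MeasurableSpace.comap_iSup,
    MeasurableSpace.comap_comp]
  rfl

theorem proj_eq_self_of_aestronglyMeasurable_delta {θ : Set.Icc (0 : ℝ) 1} {v : H}
    (hv : AEStronglyMeasurable[A.filtration π θ] (A.delta v) A.μ) : π.proj θ v = v := by
  have orthogonal (h : H) : ⟪π.proj θ h, v - π.proj θ v⟫_ℝ = 0 := by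
    rw [π.inner_proj_left, map_sub, π.proj_proj, sub_self, inner_zero_right]
  have proj_meas : Measurable[A.filtration π θ] (A.delta (π.proj θ v)) :=
    (comap_measurable _).mono
      (le_iSup (fun h => MeasurableSpace.comap (A.delta (π.proj θ h)) (borel ℝ)) v) le_rfl
  have sub_meas : AEStronglyMeasurable[A.filtration π θ] (A.delta (v - π.proj θ v)) A.μ := by
    refine (hv.sub proj_meas.stronglyMeasurable.aestronglyMeasurable).congr ?_
    rw [map_sub]
    exact (Lp.coeFn_sub _ _).symm
  rw [filtration_eq_comap] at sub_meas
  exact (sub_eq_zero.1 (A.eq_zero_of_aestronglyMeasurable_delta_comap orthogonal sub_meas)).symm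

variable {A π}

theorem IsAdapted.proj_apply_eq_zero {u : W → H} {T : H →L[ℝ] H} (hu : A.IsAdapted π u)
    (huT : ∀ x, (fun w => ⟪u w, x⟫_ℝ) =ᵐ[A.μ] A.delta (T.adjoint x)) {θ : Set.Icc (0 : ℝ) 1}
    {x : H} (hx : π.proj θ x = 0) : π.proj θ (T x) = 0 := by
  refine ext_inner_left ℝ fun h => ?_
  have fixed := A.proj_eq_self_of_aestronglyMeasurable_delta π
    ((hu θ h).congr (huT (π.proj θ h)))
  calc ⟪h, π.proj θ (T x)⟫_ℝ = ⟪T.adjoint (π.proj θ h), x⟫_ℝ := by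
        rw [ContinuousLinearMap.adjoint_inner_left, π.inner_proj_left]
    _ = ⟪T.adjoint (π.proj θ h), π.proj θ x⟫_ℝ := by rw [← π.inner_proj_left, fixed]
    _ = ⟪h, 0⟫_ℝ := by rw [hx, inner_zero_right, inner_zero_right]

end AbstractWienerSpace

theorem two_rpow_neg_succ_mul (α : ℝ) (i : ℕ) :
    (2 : ℝ) ^ (-((i : ℝ) + 1) * α) = ((2 : ℝ) ^ (-α)) ^ (i + 1) := by
  rw [← Real.rpow_mul_natCast zero_le_two]
  push_cast
  ring_nf

theorem antitone_two_rpow_neg_succ_mul {α : ℝ} (hα : 0 < α) :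
    Antitone fun i : ℕ => (2 : ℝ) ^ (-((i : ℝ) + 1) * α) := fun i j hij =>
  Real.rpow_le_rpow_of_exponent_le one_le_two (by gcongr)

theorem summable_sq_two_rpow_neg_succ_mul {α : ℝ} (hα : 0 < α) :
    Summable fun i : ℕ => ((2 : ℝ) ^ (-((i : ℝ) + 1) * α)) ^ 2 := by
  have base_lt_one : ((2 : ℝ) ^ (-α)) ^ 2 < 1 :=
    pow_lt_one₀ (by positivity)
      (Real.rpow_lt_one_of_one_lt_of_neg one_lt_two (neg_lt_zero.2 hα)) two_ne_zero
  simp only [two_rpow_neg_succ_mul, pow_right_comm _ _ 2]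
  exact (summable_nat_add_iff 1).2 (summable_geometric_of_lt_one (sq_nonneg _) base_lt_one)

namespace AbstractWienerSpace

variable {W H : Type*} [NormedAddCommGroup W] [NormedSpace ℝ W] [MeasurableSpace W] [BorelSpace W]
  [NormedAddCommGroup H] [InnerProductSpace ℝ H] [CompleteSpace H]

/-- The functional `∑ᵢ aᵢ δ(e (i + 1)) e i`, whose gradient is the weighted backward shift with
weights `aᵢ`. -/
noncomputable def weightedShiftField (A : AbstractWienerSpace W H) (e : HilbertBasis ℕ ℝ H)
    (a : ℕ → ℝ) (w : W) : H :=
  ∑' i : ℕ, (a i * A.delta (e (i + 1)) w) • e i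

variable (A : AbstractWienerSpace W H) (e : HilbertBasis ℕ ℝ H) {a : ℕ → ℝ}

theorem ae_forall_delta_smul_succ (a : ℕ → ℝ) :
    ∀ᵐ w ∂A.μ, ∀ i, A.delta (a i • e (i + 1)) w = a i * A.delta (e (i + 1)) w :=
  ae_all_iff.2 fun i => by
    rw [map_smul]
    exact Lp.coeFn_smul _ _

theorem ae_summable_weightedShiftField (hsum : Summable fun i => a i ^ 2) :
    ∀ᵐ w ∂A.μ, Summable fun i => (a i * A.delta (e (i + 1)) w) • e i := by
  filter_upwards [A.ae_summable_delta_smul e.orthonormal (summable_norm_sq_smul_succ e hsum),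
    A.ae_forall_delta_smul_succ e a] with w summable delta_eq
  simpa only [delta_eq] using summable

theorem ae_hasSum_weightedShiftField (hsum : Summable fun i => a i ^ 2) :
    ∀ᵐ w ∂A.μ, HasSum (fun i => A.delta (a i • e (i + 1)) w • e i)
      (A.weightedShiftField e a w) := by
  filter_upwards [A.ae_summable_weightedShiftField e hsum, A.ae_forall_delta_smul_succ e a]
    with w summable delta_eq
  simpa only [delta_eq, weightedShiftField] using summable.hasSum

variable {B : H →L[ℝ] H}

theorem isGradient_weightedShiftField (hsum : Summable fun i => a i ^ 2)
    (hB : IsWeightedBackwardShift e a B) :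
    A.IsGradient (A.weightedShiftField e a) fun _ => B :=
  A.isGradient_of_ae_hasSum_delta_smul e.orthonormal (summable_norm_sq_smul_succ e hsum)
    (A.ae_hasSum_weightedShiftField e hsum)
    hB.hasSum_inner_smul

theorem inner_weightedShiftField_ae_eq (hsum : Summable fun i => a i ^ 2)
    (hB : IsWeightedBackwardShift e a B) (x : H) :
    (fun w => ⟪A.weightedShiftField e a w, x⟫_ℝ) =ᵐ[A.μ] A.delta (B.adjoint x) :=
  inner_ae_eq_delta_adjoint e (A.ae_hasSum_weightedShiftField e hsum)
    hB.hasSum_inner_smul x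

theorem not_isAdapted_weightedShiftField (ha : Antitone a) (ha0 : ∀ i, 0 < a i)
    (hsum : Summable fun i => a i ^ 2) (π : ContinuousResolution H) :
    ¬ A.IsAdapted π (A.weightedShiftField e a) := by
  obtain ⟨B, hB⟩ := exists_isWeightedBackwardShift e hsum
  exact fun adapted => hB.not_forall_mem_ker ha ha0 hsum π fun _ _ =>
    adapted.proj_apply_eq_zero (A.inner_weightedShiftField_ae_eq e hsum hB)

end AbstractWienerSpace

theorem mainTheorem6_general {W H : Type*}
    [NormedAddCommGroup W] [NormedSpace ℝ W] [MeasurableSpace W] [BorelSpace W]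
    [NormedAddCommGroup H] [InnerProductSpace ℝ H] [CompleteSpace H]
    (A : AbstractWienerSpace W H) (e : HilbertBasis ℕ ℝ H) {a : ℕ → ℝ} (ha : Antitone a)
    (ha0 : ∀ i, 0 < a i) (hsum : Summable fun i => a i ^ 2) :
    (∀ᵐ w ∂A.μ, Summable fun i => (a i * A.delta (e (i + 1)) w) • e i) ∧
    A.MemD21 (A.weightedShiftField e a) ∧
    (∀ G : W → H →L[ℝ] H, A.IsGradient (A.weightedShiftField e a) G →
      ∀ᵐ w ∂A.μ, IsWeightedBackwardShift e a (G w)) ∧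
    A.HasQuasinilpotentGradient (A.weightedShiftField e a) ∧
    (¬ ∃ π : ContinuousResolution H, A.IsAdapted π (A.weightedShiftField e a)) ∧
    ¬ (∀ v : W → H, A.MemD21 v → A.HasQuasinilpotentGradient v →
      ∃ π : ContinuousResolution H, A.IsAdapted π v) := by
  obtain ⟨B, hB⟩ := exists_isWeightedBackwardShift e hsum
  have gradient := A.isGradient_weightedShiftField e hsum hB
  have gradient_shift (G : W → H →L[ℝ] H) (hG : A.IsGradient (A.weightedShiftField e a) G) :
      ∀ᵐ w ∂A.μ, IsWeightedBackwardShift e a (G w) :=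
    (hG.ae_eq e gradient).mono fun w hw => hw ▸ hB
  have quasinilpotent : A.HasQuasinilpotentGradient (A.weightedShiftField e a) := fun G hG =>
    (gradient_shift G hG).mono fun w hw => hw.isQuasinilpotent ha (fun i => (ha0 i).le) hsum
  have not_adapted : ¬ ∃ π : ContinuousResolution H, A.IsAdapted π (A.weightedShiftField e a) :=
    fun ⟨π, hπ⟩ => A.not_isAdapted_weightedShiftField e ha ha0 hsum π hπ
  exact ⟨A.ae_summable_weightedShiftField e hsum, ⟨_, gradient⟩, gradient_shift, quasinilpotent,
    not_adapted, fun h => not_adapted (h _ ⟨_, gradient⟩ quasinilpotent)⟩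

theorem mainTheorem6 {W H : Type*}
    [NormedAddCommGroup W] [NormedSpace ℝ W] [CompleteSpace W] [TopologicalSpace.SeparableSpace W]
    [MeasurableSpace W] [BorelSpace W]
    [NormedAddCommGroup H] [InnerProductSpace ℝ H] [CompleteSpace H]
    (A : AbstractWienerSpace W H) (e : HilbertBasis ℕ ℝ H) (α : ℝ) (hα : 0 < α) :
    -- the series defining `u` converges almost surely in `H`
    (∀ᵐ w ∂A.μ, Summable fun i : ℕ =>
      ((2 : ℝ) ^ (-((i : ℝ) + 1) * α) * A.delta (e (i + 1)) w) • e i) ∧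
    A.MemD21 (A.shiftField e α) ∧
    -- `∇u` is almost surely the weighted shift `h ↦ ∑ 2^{-iα} (e_{i+1}, h) e_i`
    (∀ G : W → H →L[ℝ] H, A.IsGradient (A.shiftField e α) G → ∀ᵐ w ∂A.μ, ∀ h : H,
      HasSum (fun i : ℕ => ((2 : ℝ) ^ (-((i : ℝ) + 1) * α) * ⟪e (i + 1), h⟫_ℝ) • e i) (G w h)) ∧
    A.HasQuasinilpotentGradient (A.shiftField e α) ∧
    (¬ ∃ π : ContinuousResolution H, A.IsAdapted π (A.shiftField e α)) ∧
    -- hence the converse of "adapted implies quasinilpotent gradient" fails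
    ¬ (∀ v : W → H, A.MemD21 v → A.HasQuasinilpotentGradient v →
      ∃ π : ContinuousResolution H, A.IsAdapted π v) :=
  mainTheorem6_general A e (antitone_two_rpow_neg_succ_mul hα)
    (fun _ => Real.rpow_pos_of_pos two_pos _) (summable_sq_two_rpow_neg_succ_mul hα)
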